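/- Let $k$ be a field of characteristic zero, $v$ an indeterminate, and let $\mathbf U$ be the quantized enveloping algebra of $\mathfrak{sl}(2)$ over $k(v)$: it has generators $E,F,K^{\pm1}$ and relations $[E,F]=\frac{K-K^{-1}}{v-v^{-1}}$, $KEK^{-1}=v^2E$, $KFK^{-1}=v^{-2}F$, $KK^{-1}=K^{-1}K=1$. Let $\varrho$ be the anti-automorphism of $\mathbf U$ with $\varrho(E)=vKF$, $\varrho(F)=vK^{-1}E$, $\varrho(K)=K$. Let $R=k(v)[[T-1]]$, with fraction field $\mathcal K$, and ${}_R\mathbf U=R\otimes_{k(v)}\mathbf U$. For $a\in\mathcal K$ let $\mathrm{ord}(a)\in\mathbb Z\cup\{\infty\}$ be the order of $a$ at $T-1$, with $\mathrm{ord}(0)=\infty$, and put $[T;0]=\frac{T-T^{-1}}{v-v^{-1}}$. A bilinear form $\phi$ on an ${}_R\mathbf U$-module is invariant if $\phi(ua,b)=\phi(a,\varrho(u)b)$ for all $u\in\mathbf U$. Fix an integer $r\ge 1$. For $l=\pm r$ let $M(m+l)$ be the Verma module over ${}_R\mathbf U$ of highest weight $Tv^{l-1}$, with highest weight vector $1_{l}$.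 Put $w_{+,j}=F^j1_{r}$ and $w_{-,j}=F^j1_{-r}$ for $j\ge 0$, and write $w_+=w_{+,r}$, $w_-=w_{-,0}$; these two vectors have the same weight $Tv^{-r-1}$. Let $P=P_r=P(m+r)$ be the ${}_R\mathbf U$-submodule of $(M(m+r)\oplus M(m-r))\otimes_R\mathcal K$ with $R$-basis $$\{[T;0]\,w_{+,j} : j\ge 0\}\ \cup\ \{w_{+,r+j}+w_{-,j} : j\ge 0\}.$$ Let $\phi_\pm$ be the $\mathcal K$-valued Shapovalov form (invariant form) on $M(m\pm r)\otimes_R\mathcal K$, normalized by $\phi_+(w_+,w_+)=1$ and $\phi_-(w_-,w_-)=1$. Let $\phi$ be an $R$-valued invariant form on an ${}_R\mathbf U$-module $N$ that contains a copy of $P$ as a submodule (for example $N=M(m)\otimes_R\mathcal F$ with $\mathcal F$ finite dimensional and $P$ a summand of it). Then there are unique $b_\pm\in\mathcal K$ with $$\phi|_P=b_+\phi_++b_-\phi_-.$$ The form $\phi|_P$ induces the filtration $P^i=\{x\in P : \phi(x,P)\subset (T-1)^iR\}$, $i\ge 0$, of $P$. Write $\overline B=B/(T-1)B$ for an $R$-module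 $B$, and let $\overline{P^i}$ denote the image of $P^i$ in $\overline P$. For $0\le a\le b\le c\le\infty$, the filtration is of type $(a,b,c)$ if, for all $i\geq 0$: $\overline{P^i}=\overline P$ when $i\le a$; $\overline{P^i}\cong\overline{M(m+r)}$ when $a<i\le b$; $\overline{P^i}\cong\overline{M(m-r)}$ when $b<i\le c$; and $\overline{P^i}=0$ when $i>c$. Then: (a) If $\mathrm{ord}(b_+)=\mathrm{ord}(b_-)<\mathrm{ord}(b_++b_-)$, the filtration is of type $(a,a,a)$ with $a=\mathrm{ord}(b_+)+1$. (b) If $\mathrm{ord}(b_++b_-)=\mathrm{ord}(b_+)\le\mathrm{ord}(b_-)$, the filtration is of type $(\mathrm{ord}(b_+),\ \mathrm{ord}(b_+)+1,\ \mathrm{ord}(b_-)+2)$. (c) If $\mathrm{ord}(b_++b_-)=\mathrm{ord}(b_-)\le\mathrm{ord}(b_+)$, the filtration is of type $(\mathrm{ord}(b_-),\ \mathrm{ord}(b_+)+1,\ \mathrm{ord}(b_+)+2)$. -/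

import Mathlib

noncomputable section

namespace QuantumSl2

/-! ### The coefficient rings -/

/-- The field `k(v)`. -/
abbrev Kv (k : Type*) [Field k] : Type _ := RatFunc k

/-- The ring `R = k(v)[[T - 1]]`; the power series variable is `T - 1`. -/
abbrev R (k : Type*) [Field k] : Type _ := PowerSeries (Kv k)

/-- The field of fractions of `R`. -/
abbrev FracR (k : Type*) [Field k] : Type _ := FractionRing (R k)

variable (k : Type*) [Field k]

/-- The indeterminate `v` of `k(v)`. -/
def v : Kv k := RatFunc.X

/-- The uniformizer `T - 1` of `R`. -/
def unif : R k := PowerSeries.X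

/-- The element `T` of `R`. -/
def T : R k := 1 + unif k

/-- The quantum integer `[m] = (v ^ m - v ^ (-m)) / (v - v⁻¹)`. -/
def qInt (m : ℤ) : Kv k := (v k ^ m - v k ^ (-m)) / (v k - (v k)⁻¹)

/-- `[T; m] = (v ^ m T - v ^ (-m) T⁻¹) / (v - v⁻¹)`. -/
def qT (m : ℤ) : R k :=
  (v k - (v k)⁻¹)⁻¹ • (v k ^ m • T k - v k ^ (-m) • (T k)⁻¹)

/-- The order at `T - 1` of an element of the fraction field of `R`, that is, its order as a
Laurent series in `T - 1`; the order of `0` is `⊤`. -/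
def ord {k : Type*} [Field k] (a : FracR k) : WithTop ℤ :=
  HahnSeries.orderTop (FractionRing.algEquiv (R k) (LaurentSeries (Kv k)) a)

/-! ### The quantized enveloping algebra -/

/-- Names of the generators `E, F, K, K⁻¹`. -/
inductive Gen : Type
  | E | F | K | Kinv

/-- The defining relations of the quantized enveloping algebra of `sl(2)`, for four elements
of a `k(v)`-algebra. -/
structure Relations {B : Type*} [Ring B] [Algebra (Kv k) B] (e f κ κ' : B) : Prop where
  comm : e * f - f * e = (v k - (v k)⁻¹)⁻¹ • (κ - κ')
  conj_e : κ * e * κ' = v k ^ 2 • e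
  conj_f : κ * f * κ' = (v k ^ 2)⁻¹ • f
  mul_inv : κ * κ' = 1
  inv_mul : κ' * κ = 1

open FreeAlgebra in
/-- The relations, on the free algebra. -/
inductive Rel : FreeAlgebra (Kv k) Gen → FreeAlgebra (Kv k) Gen → Prop
  | comm : Rel (ι _ Gen.E * ι _ Gen.F - ι _ Gen.F * ι _ Gen.E)
      ((v k - (v k)⁻¹)⁻¹ • (ι _ Gen.K - ι _ Gen.Kinv))
  | conj_e : Rel (ι _ Gen.K * ι _ Gen.E * ι _ Gen.Kinv) (v k ^ 2 • ι _ Gen.E)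
  | conj_f : Rel (ι _ Gen.K * ι _ Gen.F * ι _ Gen.Kinv) ((v k ^ 2)⁻¹ • ι _ Gen.F)
  | mul_inv : Rel (ι _ Gen.K * ι _ Gen.Kinv) 1
  | inv_mul : Rel (ι _ Gen.Kinv * ι _ Gen.K) 1

/-- The quantized enveloping algebra `U` of `sl(2)` over `k(v)`. -/
abbrev U : Type _ := RingQuot (Rel k)

/-- The generators of `U`. -/
def gen (g : Gen) : U k := RingQuot.mkAlgHom (Kv k) (Rel k) (FreeAlgebra.ι (Kv k) g)

theorem relations_gen :
    Relations k (gen k Gen.E) (gen k Gen.F) (gen k Gen.K) (gen k Gen.Kinv) where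
  comm := by
    have h := RingQuot.mkAlgHom_rel (Kv k) (Rel.comm (k := k))
    simpa [gen] using h
  conj_e := by
    have h := RingQuot.mkAlgHom_rel (Kv k) (Rel.conj_e (k := k))
    simpa [gen] using h
  conj_f := by
    have h := RingQuot.mkAlgHom_rel (Kv k) (Rel.conj_f (k := k))
    simpa [gen] using h
  mul_inv := by
    have h := RingQuot.mkAlgHom_rel (Kv k) (Rel.mul_inv (k := k))
    simpa [gen] using h
  inv_mul := by
    have h := RingQuot.mkAlgHom_rel (Kv k) (Rel.inv_mul (k := k))
    simpa [gen] using h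

variable {k}

/-- The values on the generators of an algebra map out of `U`. -/
def genVal {B : Type*} (e f κ κ' : B) : Gen → B
  | Gen.E => e
  | Gen.F => f
  | Gen.K => κ
  | Gen.Kinv => κ'

/-- The algebra map out of `U` with prescribed values on the generators. -/
def liftU {B : Type*} [Ring B] [Algebra (Kv k) B] {e f κ κ' : B}
    (h : Relations k e f κ κ') : U k →ₐ[Kv k] B :=
  RingQuot.liftAlgHom (Kv k) ⟨FreeAlgebra.lift (Kv k) (genVal e f κ κ'), by
    intro x y hxy
    cases hxy
    · simpa [genVal] using h.comm
    · simpa [genVal] using h.conj_e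
    · simpa [genVal] using h.conj_f
    · simpa [genVal] using h.mul_inv
    · simpa [genVal] using h.inv_mul⟩

theorem liftU_gen {B : Type*} [Ring B] [Algebra (Kv k) B] {e f κ κ' : B}
    (h : Relations k e f κ κ') (g : Gen) : liftU h (gen k g) = genVal e f κ κ' g := by
  simp [liftU, gen]


variable (k) in
/-- The anti-automorphism `ϱ` of `U`, with `ϱ(E) = v K F`, `ϱ(F) = v K⁻¹ E`, `ϱ(K) = K`. -/
def antiAut : U k →ₐ[Kv k] (U k)ᵐᵒᵖ :=
  liftU (e := MulOpposite.op (v k • (gen k Gen.K * gen k Gen.F)))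
    (f := MulOpposite.op (v k • (gen k Gen.Kinv * gen k Gen.E)))
    (κ := MulOpposite.op (gen k Gen.K)) (κ' := MulOpposite.op (gen k Gen.Kinv)) (by
      have h := relations_gen k
      have hv : v k ≠ 0 := RatFunc.X_ne_zero
      set E := gen k Gen.E
      set F := gen k Gen.F
      set K := gen k Gen.K
      set K' := gen k Gen.Kinv
      have h4 := h.mul_inv
      have h5 := h.inv_mul
      have hE : K' * E * K = (v k ^ 2)⁻¹ • E := by
        have : v k ^ 2 • (K' * E * K) = E := by
          calc v k ^ 2 • (K' * E * K) = K' * (v k ^ 2 • E) * K := by simp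
            _ = (K' * K) * E * (K' * K) := by rw [← h.conj_e]; simp only [mul_assoc]
            _ = E := by simp [h5]
        rw [← this, smul_smul, inv_mul_cancel₀ (pow_ne_zero 2 hv), one_smul, this]
      refine ⟨?_, ?_, ?_, ?_, ?_⟩
      · apply MulOpposite.unop_injective
        have e1 : K' * E * (K * F) = (v k ^ 2)⁻¹ • (E * F) := by
          rw [← mul_assoc, hE, smul_mul_assoc]
        have e2 : K * F * (K' * E) = (v k ^ 2)⁻¹ • (F * E) := by
          rw [← mul_assoc, h.conj_f, smul_mul_assoc]
        have : v k * v k * (v k ^ 2)⁻¹ = 1 := by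
          rw [← pow_two]; exact mul_inv_cancel₀ (pow_ne_zero 2 hv)
        simp only [MulOpposite.unop_sub, MulOpposite.unop_mul, MulOpposite.unop_op,
          MulOpposite.unop_smul, smul_mul_smul_comm, e1, e2, smul_smul, this, one_smul]
        exact h.comm
      · apply MulOpposite.unop_injective
        have e1 : K' * (K * F * K) = v k ^ 2 • (K * F) := by
          have : v k ^ 2 • (K * F * K') = F := by
            rw [h.conj_f, smul_smul, mul_inv_cancel₀ (pow_ne_zero 2 hv), one_smul]
          calc K' * (K * F * K) = F * K := by simp [← mul_assoc, h5]
            _ = (v k ^ 2 • (K * F * K')) * K := by rw [this]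
            _ = _ := by simp [mul_assoc, h5]
        simp only [MulOpposite.unop_mul, MulOpposite.unop_op,
          MulOpposite.unop_smul, mul_smul_comm, smul_mul_assoc, e1]
        rw [smul_comm]
      · apply MulOpposite.unop_injective
        have e1 : K' * (K' * E * K) = (v k ^ 2)⁻¹ • (K' * E) := by
          rw [hE, mul_smul_comm]
        simp only [MulOpposite.unop_mul, MulOpposite.unop_op,
          MulOpposite.unop_smul, mul_smul_comm, smul_mul_assoc, e1]
        rw [smul_comm]
      · rw [← MulOpposite.op_mul, h5, MulOpposite.op_one]
      · rw [← MulOpposite.op_mul, h4, MulOpposite.op_one])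

open scoped TensorProduct

variable (k) in
/-- The extension of scalars `R ⊗ U` of `U` to `R`. -/
abbrev RU : Type _ := R k ⊗[Kv k] U k

/-! ### Modules over `R ⊗ U`

An `R ⊗ U`-module is an `R`-module `N` with an algebra map `RU k →ₐ[R k] Module.End (R k) N`. -/

/-- The element `1 ⊗ u` of `R ⊗ U`. -/
def inU (u : U k) : RU k := 1 ⊗ₜ[Kv k] u

/-- Extension to `R ⊗ U` of an action of `U` by `R`-linear maps. -/
def extendRep {N : Type*} [AddCommGroup N] [Module (R k) N] [Module (Kv k) N]
    [IsScalarTower (Kv k) (R k) N]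
    (f : U k →ₐ[Kv k] Module.End (R k) N) : RU k →ₐ[R k] Module.End (R k) N :=
  Algebra.TensorProduct.lift (Algebra.ofId (R k) (Module.End (R k) N)) f
    fun r u => (Algebra.commutes r (f u) : _ * _ = _ * _)

theorem extendRep_inU {N : Type*} [AddCommGroup N] [Module (R k) N] [Module (Kv k) N]
    [IsScalarTower (Kv k) (R k) N]
    (f : U k →ₐ[Kv k] Module.End (R k) N) (u : U k) : extendRep f (inU u) = f u := by
  refine (Algebra.TensorProduct.lift_tmul _ _ _ _ _).trans ?_
  rw [map_one, one_mul]

/-- The direct sum of two modules. -/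
def prodRep {N N' : Type*} [AddCommGroup N] [Module (R k) N] [AddCommGroup N'] [Module (R k) N']
    (π : RU k →ₐ[R k] Module.End (R k) N) (π' : RU k →ₐ[R k] Module.End (R k) N') :
    RU k →ₐ[R k] Module.End (R k) (N × N') :=
  (LinearMap.prodMapAlgHom (R k) N N').comp (π.prod π')

/-- The action on an invariant `R`-submodule. -/
def subRep {N : Type*} [AddCommGroup N] [Module (R k) N]
    (π : RU k →ₐ[R k] Module.End (R k) N) (P : Submodule (R k) N)
    (h : ∀ u, ∀ x ∈ P, π u x ∈ P) : RU k →ₐ[R k] Module.End (R k) P :=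
  AlgHom.ofLinearMap
    { toFun := fun u => (π u).restrict (h u)
      map_add' := fun u u' => by ext; simp
      map_smul' := fun c u => by ext; simp }
    (by ext; simp) (fun u u' => by ext; simp)

/-- An `R`-submodule that is stable under the generators of `U` is stable under `R ⊗ U`. -/
theorem stable_of_gen {N : Type*} [AddCommGroup N] [Module (R k) N]
    (π : RU k →ₐ[R k] Module.End (R k) N) (P : Submodule (R k) N)
    (h : ∀ g, ∀ x ∈ P, π (inU (gen k g)) x ∈ P) : ∀ u, ∀ x ∈ P, π u x ∈ P := by
  have hsm : ∀ (c : R k) (u : U k), (c ⊗ₜ[Kv k] u : RU k) = c • inU u := by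
    intro c u
    simp [inU, TensorProduct.smul_tmul']
  have hU : ∀ u : U k, ∀ x ∈ P, π (inU u) x ∈ P := by
    intro u
    obtain ⟨y, rfl⟩ := RingQuot.mkAlgHom_surjective (Kv k) (Rel k) u
    induction y using FreeAlgebra.induction with
    | grade0 c =>
      intro x hx
      have : inU (RingQuot.mkAlgHom (Kv k) (Rel k) (algebraMap (Kv k) _ c))
          = (algebraMap (Kv k) (R k) c) • (1 : RU k) := by
        rw [AlgHom.commutes, Algebra.algebraMap_eq_smul_one, inU, TensorProduct.tmul_smul,
          algebraMap_smul]
        rfl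
      rw [this, map_smul, map_one]
      exact P.smul_mem _ hx
    | grade1 g => exact h g
    | mul a b ha hb =>
      intro x hx
      have : ∀ a b : U k, inU (a * b) = inU a * inU b := fun a b => by simp [inU]
      rw [map_mul, this, map_mul]
      exact ha _ (hb _ hx)
    | add a b ha hb =>
      intro x hx
      have : ∀ a b : U k, inU (a + b) = inU a + inU b := fun a b => by
        simp [inU, TensorProduct.tmul_add]
      rw [map_add, this, map_add]
      exact P.add_mem (ha _ hx) (hb _ hx)
  intro u
  induction u using TensorProduct.induction_on with
  | zero => intro x _; simp
  | tmul c u =>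
    intro x hx
    rw [hsm, map_smul]
    exact P.smul_mem _ (hU u x hx)
  | add a b ha hb =>
    intro x hx
    rw [map_add]
    exact P.add_mem (ha x hx) (hb x hx)

/-! ### Verma modules -/

section Verma

variable (S : Type*) [CommRing S] [Algebra (R k) S]

/-- The `R`-linear endomorphism of `⨁ S w_j` that sends `s w_j` to `c j s w_(g j)`. -/
def wOp (c : ℕ → R k) (g : ℕ → ℕ) : Module.End (R k) (ℕ →₀ S) :=
  Finsupp.lsum ℕ fun j => (Finsupp.lsingle (g j)) ∘ₗ (c j • (LinearMap.id : S →ₗ[R k] S))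

theorem wOp_single (c : ℕ → R k) (g : ℕ → ℕ) (j : ℕ) (s : S) :
    wOp S c g (Finsupp.single j s) = Finsupp.single (g j) (c j • s) := by
  simp [wOp]

/-- The action of `E` : `E w_j = [j] [T; l - j] w_(j - 1)`. -/
def opE (l : ℤ) : Module.End (R k) (ℕ →₀ S) :=
  wOp S (fun j => qInt k j • qT k (l - j)) (fun j => j - 1)

variable (k) in
/-- The action of `F` : `F w_j = w_(j + 1)`. -/
def opF : Module.End (R k) (ℕ →₀ S) := wOp S (fun _ => 1) (fun j => j + 1)

/-- The action of `K` : `K w_j = T v ^ (l - 1 - 2 j) w_j`. -/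
def opK (l : ℤ) : Module.End (R k) (ℕ →₀ S) :=
  wOp S (fun j => v k ^ (l - 1 - 2 * j) • T k) (fun j => j)

/-- The action of `K⁻¹` : `K⁻¹ w_j = T⁻¹ v ^ (-(l - 1 - 2 j)) w_j`. -/
def opKinv (l : ℤ) : Module.End (R k) (ℕ →₀ S) :=
  wOp S (fun j => v k ^ (-(l - 1 - 2 * j)) • (T k)⁻¹) (fun j => j)

theorem T_mul_inv : T k * (T k)⁻¹ = 1 :=
  PowerSeries.mul_inv_cancel _ (by simp [T, unif])

theorem v_sub_ne : v k - (v k)⁻¹ ≠ 0 := by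
  intro h
  have hv : (v k : Kv k) ≠ 0 := RatFunc.X_ne_zero
  have h2 : v k ^ 2 = 1 := by
    have := sub_eq_zero.mp h
    field_simp at this
    exact this
  have h3 : (algebraMap (Polynomial k) (Kv k)) (Polynomial.X ^ 2) = algebraMap _ _ 1 := by
    simpa [v, RatFunc.algebraMap_X] using h2
  have h4 := RatFunc.algebraMap_injective k h3
  have := congrArg (fun p => Polynomial.coeff p 0) h4
  simp at this

theorem comm_scalar (l : ℤ) (j : ℤ) :
    qInt k (j + 1) • qT k (l - (j + 1)) - qInt k j • qT k (l - j)
      = (v k - (v k)⁻¹)⁻¹ • (v k ^ (l - 1 - 2 * j) • T k - v k ^ (-(l - 1 - 2 * j)) • (T k)⁻¹) := by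
  have hv : (v k : Kv k) ≠ 0 := RatFunc.X_ne_zero
  have hd := v_sub_ne (k := k)
  have hd2 : v k ^ 2 - 1 ≠ 0 := by
    intro h
    apply hd
    field_simp
    rw [h, mul_zero]
  simp only [qT, smul_sub, smul_smul]
  rw [sub_sub_sub_comm, ← sub_smul, ← sub_smul]
  congr 2
  all_goals
    simp only [qInt, zpow_sub₀ hv, zpow_add₀ hv, zpow_neg, zpow_one, two_mul]
    field_simp
    ring

variable [Module (Kv k) S] [IsScalarTower (Kv k) (R k) S]

theorem add_scalar (r j : ℤ) :
    qInt k (r + j) • qT k (-j) = qInt k j • qT k (-r - j) + qInt k r • qT k 0 := by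
  have hv : (v k : Kv k) ≠ 0 := RatFunc.X_ne_zero
  have hd := v_sub_ne (k := k)
  have hd2 : v k ^ 2 - 1 ≠ 0 := by
    intro h
    apply hd
    field_simp
    rw [h, mul_zero]
  simp only [qT, smul_sub, smul_smul]
  rw [sub_add_sub_comm, ← add_smul, ← add_smul]
  congr 2
  all_goals
    simp only [qInt, zpow_sub₀ hv, zpow_add₀ hv, zpow_neg, zpow_zero, neg_add_rev, neg_sub,
      sub_neg_eq_add, neg_zero]
    field_simp
    ring

theorem verma_relations (l : ℤ) :
    Relations k (opE S l) (opF k S) (opK S l) (opKinv S l) where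
  comm := by
    refine Finsupp.lhom_ext fun j s => ?_
    have h := comm_scalar (k := k) l j
    have e0 : ∀ j : ℕ, wOp S (k := k) (fun _ => 1) (fun j => j + 1)
        (Finsupp.single (j - 1) ((qInt k j • qT k (l - j)) • s))
        = Finsupp.single j ((qInt k j • qT k (l - j)) • s) := by
      intro j
      rw [wOp_single, one_smul]
      cases j with
      | zero => simp [qInt]
      | succ j => simp
    simp only [opE, opF, opK, opKinv, LinearMap.sub_apply, Module.End.mul_apply,
      LinearMap.smul_apply, wOp_single, one_smul] at e0 ⊢
    rw [e0, Nat.add_sub_cancel, ← Finsupp.single_sub, ← Finsupp.single_sub, Finsupp.smul_single,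
      ← sub_smul, ← sub_smul, ← smul_assoc, ← h]
    push_cast
    rfl
  conj_e := by
    have hv : (v k : Kv k) ≠ 0 := RatFunc.X_ne_zero
    refine Finsupp.lhom_ext fun j s => ?_
    simp only [opE, opK, opKinv, Module.End.mul_apply, LinearMap.smul_apply, wOp_single,
      Finsupp.smul_single, smul_smul, ← smul_assoc]
    congr 2
    cases j with
    | zero => simp [qInt]
    | succ j =>
      have e : v k ^ (l - 1 - 2 * ((j + 1 - 1 : ℕ) : ℤ)) * v k ^ (-(l - 1 - 2 * ((j + 1 : ℕ) : ℤ)))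
          = v k ^ 2 := by
        rw [← zpow_add₀ hv, ← zpow_natCast]
        congr 1
        push_cast
        simp
        ring
      calc _ = (v k ^ (l - 1 - 2 * ((j + 1 - 1 : ℕ) : ℤ))
              * v k ^ (-(l - 1 - 2 * ((j + 1 : ℕ) : ℤ)))) •
            ((T k * (T k)⁻¹) * (qInt k ((j + 1 : ℕ) : ℤ) • qT k (l - ((j + 1 : ℕ) : ℤ)))) := by
            simp only [smul_mul_assoc, mul_smul_comm, smul_smul]
            congr 1
            · ring
            · ring
        _ = _ := by rw [e, T_mul_inv, one_mul, smul_smul]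
  conj_f := by
    have hv : (v k : Kv k) ≠ 0 := RatFunc.X_ne_zero
    refine Finsupp.lhom_ext fun j s => ?_
    simp only [opF, opK, opKinv, Module.End.mul_apply, LinearMap.smul_apply, wOp_single,
      Finsupp.smul_single, smul_smul, one_smul]
    rw [← smul_one_smul (R k) ((v k ^ 2)⁻¹) s]
    congr 2
    have e : v k ^ (l - 1 - 2 * ((j + 1 : ℕ) : ℤ)) * v k ^ (-(l - 1 - 2 * (j : ℤ)))
        = (v k ^ 2)⁻¹ := by
      rw [← zpow_add₀ hv, ← zpow_natCast, ← zpow_neg]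
      congr 1
      push_cast
      ring
    rw [one_mul, smul_mul_smul_comm, e, T_mul_inv]
  mul_inv := by
    have hv : (v k : Kv k) ≠ 0 := RatFunc.X_ne_zero
    refine Finsupp.lhom_ext fun j s => ?_
    simp only [opK, opKinv, Module.End.mul_apply, wOp_single, Module.End.one_apply, smul_smul,
      smul_mul_smul_comm]
    rw [← zpow_add₀ hv, add_neg_cancel, zpow_zero, T_mul_inv, one_smul, one_smul]
  inv_mul := by
    have hv : (v k : Kv k) ≠ 0 := RatFunc.X_ne_zero
    refine Finsupp.lhom_ext fun j s => ?_
    simp only [opK, opKinv, Module.End.mul_apply, wOp_single, Module.End.one_apply, smul_smul,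
      smul_mul_smul_comm]
    rw [← zpow_add₀ hv, neg_add_cancel, zpow_zero, mul_comm, T_mul_inv, one_smul, one_smul]

/-- The Verma module `M(m + l)` of highest weight `T v ^ (l - 1)`, with coefficients extended
to the `R`-algebra `S`: the free `S`-module on the vectors `w_j = F ^ j w_0`. -/
def verma (l : ℤ) : RU k →ₐ[R k] Module.End (R k) (ℕ →₀ S) :=
  extendRep (liftU (verma_relations S l))

theorem verma_gen (l : ℤ) (g : Gen) : verma S l (inU (gen k g))
    = genVal (opE S l) (opF k S) (opK S l) (opKinv S l) g := by
  rw [verma, extendRep_inU, liftU_gen]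

end Verma

/-! ### The module `P(m + r)` -/

variable (k) in
/-- The space underlying the direct sum of the Verma modules `M(m + r)` and `M(m - r)`, with
coefficients extended to the fraction field of `R`. -/
abbrev VV : Type _ := (ℕ →₀ FracR k) × (ℕ →₀ FracR k)

variable (k) in
/-- The action on the direct sum of `M(m + r)` and `M(m - r)`. -/
def repVV (r : ℕ) : RU k →ₐ[R k] Module.End (R k) (VV k) :=
  prodRep (k := k) (verma (k := k) (FracR k) (r : ℤ)) (verma (k := k) (FracR k) (-(r : ℤ)))

variable (k) in
/-- The basis vector `F ^ j w` of `M(m + r)`, of weight `T v ^ (r - 1 - 2 j)`. -/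
def wPlus (j : ℕ) : VV k := (Finsupp.single j 1, 0)

variable (k) in
/-- The basis vector `F ^ j w` of `M(m - r)`, of weight `T v ^ (- r - 1 - 2 j)`. -/
def wMinus (j : ℕ) : VV k := (0, Finsupp.single j 1)

variable (k) in
/-- The underlying `R`-module of `P(m + r)`, spanned over `R` by the vectors `[T; 0] w` with `w`
in the basis of `M(m + r)` and by the sums `z` of the basis vectors of equal weight in
`M(m + r)` and `M(m - r)`. -/
def P (r : ℕ) : Submodule (R k) (VV k) :=
  Submodule.span (R k) (Set.range (fun j => qT k 0 • wPlus k j) ∪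
    Set.range (fun j => wPlus k (r + j) + wMinus k j))

theorem repVV_gen (r : ℕ) (g : Gen) (x : VV k) : repVV k r (inU (gen k g)) x
    = (genVal (opE (FracR k) r) (opF k _) (opK _ r) (opKinv _ r) g x.1,
      genVal (opE (FracR k) (-r)) (opF k _) (opK _ (-r)) (opKinv _ (-r)) g x.2) := by
  rw [← verma_gen, ← verma_gen]
  rfl

theorem P_stable (r : ℕ) : ∀ u, ∀ x ∈ P k r, repVV k r u x ∈ P k r := by
  have hw : ∀ (c : R k) (j : ℕ), c • (qT k 0 • wPlus k j) ∈ P k r := fun c j =>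
    Submodule.smul_mem _ _ (Submodule.subset_span (Or.inl ⟨j, rfl⟩))
  have hz : ∀ (c : R k) (j : ℕ), c • (wPlus k (r + j) + wMinus k j) ∈ P k r := fun c j =>
    Submodule.smul_mem _ _ (Submodule.subset_span (Or.inr ⟨j, rfl⟩))
  refine stable_of_gen (repVV k r) (P k r) fun g => ?_
  suffices h : P k r ≤ (P k r).comap (repVV k r (inU (gen k g))) from fun x hx => h hx
  refine Submodule.span_le.mpr ?_
  rintro _ (⟨j, rfl⟩ | ⟨j, rfl⟩)
  · rw [SetLike.mem_coe, Submodule.mem_comap, map_smul]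
    cases g
    · convert hw (qInt k j • qT k (r - j)) (j - 1) using 1
      rw [repVV_gen, smul_comm]
      simp [wPlus, genVal, opE, wOp_single]
    · convert hw 1 (j + 1) using 1
      rw [repVV_gen]
      simp [wPlus, genVal, opF, wOp_single]
    · convert hw (v k ^ ((r : ℤ) - 1 - 2 * j) • T k) j using 1
      rw [repVV_gen, smul_comm]
      simp [wPlus, genVal, opK, wOp_single]
    · convert hw (v k ^ (-((r : ℤ) - 1 - 2 * j)) • (T k)⁻¹) j using 1
      rw [repVV_gen, smul_comm]
      simp [wPlus, genVal, opKinv, wOp_single]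
  · rw [SetLike.mem_coe, Submodule.mem_comap]
    cases g
    · have h := add_scalar (k := k) r j
      have e : repVV k r (inU (gen k Gen.E)) (wPlus k (r + j) + wMinus k j)
          = (qInt k j • qT k (-(r : ℤ) - j)) • (wPlus k (r + j - 1) + wMinus k (j - 1))
            + qInt k r • (qT k 0 • wPlus k (r + j - 1)) := by
        rw [repVV_gen, ← smul_assoc (qInt k r)]
        simp only [wPlus, wMinus, genVal, opE, wOp_single, Prod.mk_add_mk, add_zero, zero_add,
          Prod.smul_mk, Finsupp.smul_single, smul_zero, ← Finsupp.single_add, ← add_smul]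
        rw [← h]
        congr 5
        · push_cast
          ring
      rw [e, ← algebraMap_smul (R k) (M := VV k) (qInt k r)]
      refine add_mem ?_ (hw _ _)
      cases j with
      | zero => simp [qInt]
      | succ j => exact hz _ j
    · convert hz 1 (j + 1) using 1
      rw [repVV_gen]
      simp [wPlus, wMinus, genVal, opF, wOp_single, add_assoc]
    · convert hz (v k ^ (-(r : ℤ) - 1 - 2 * j) • T k) j using 1
      rw [repVV_gen]
      simp only [wPlus, wMinus, genVal, opK, wOp_single, Prod.mk_add_mk, add_zero, zero_add,
        Prod.smul_mk, Finsupp.smul_single]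
      congr 5
      push_cast
      ring
    · convert hz (v k ^ (-(-(r : ℤ) - 1 - 2 * j)) • (T k)⁻¹) j using 1
      rw [repVV_gen]
      simp only [wPlus, wMinus, genVal, opKinv, wOp_single, Prod.mk_add_mk, add_zero, zero_add,
        Prod.smul_mk, Finsupp.smul_single]
      congr 5
      push_cast
      ring

variable (k) in
/-- The action of `R ⊗ U` on `P(m + r)`. -/
def repP (r : ℕ) : RU k →ₐ[R k] Module.End (R k) (P k r) :=
  subRep (k := k) (N := VV k) (repVV k r) (P k r) (P_stable r)

/-! ### Invariant forms -/

/-- A bilinear form on an `R ⊗ U`-module, with values in an `R`-algebra `S`, is invariant if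
`φ(u a, b) = φ(a, ϱ(u) b)` for all `u` in `U`. -/
def IsInvariant {S : Type*} [CommRing S] {N : Type*} [AddCommGroup N] [Module (R k) N]
    [Module S N] (π : RU k →ₐ[R k] Module.End (R k) N) (φ : LinearMap.BilinForm S N) : Prop :=
  ∀ (u : U k) (a b : N), φ (π (inU u) a) b = φ a (π (inU (antiAut k u).unop) b)

variable (k) in
/-- `φ` is the Shapovalov form on `M(m + l)`, with values in the fraction field of `R`,
normalized by `φ(w_j, w_j) = 1`. -/
def IsShapovalov (l : ℤ) (j : ℕ) (φ : LinearMap.BilinForm (FracR k) (ℕ →₀ FracR k)) : Prop :=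
  IsInvariant (k := k) (verma (k := k) (FracR k) l) φ ∧ φ (Finsupp.single j 1) (Finsupp.single j 1) = 1

/-- The restriction of a form on `N` along `ι : B → N`, that is, `(x, y) ↦ φ(ι x, ι y)`. -/
def restrictForm {B N : Type*} [AddCommMonoid B] [Module (R k) B] [AddCommGroup N]
    [Module (R k) N] (φ : LinearMap.BilinForm (R k) N) (ι : B →ₗ[R k] N) :
    LinearMap.BilinForm (R k) B :=
  φ.compl₁₂ ι ι

/-- The form `ψ` on `P(m + r)` equals `bp φp + bm φm`, where `φp` and `φm` are forms on the two
summands `M(m + r)` and `M(m - r)`, with coefficients in the fraction field of `R`. -/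
def IsCombination {r : ℕ} (ψ : LinearMap.BilinForm (R k) (P k r))
    (φp φm : LinearMap.BilinForm (FracR k) (ℕ →₀ FracR k)) (bp bm : FracR k) : Prop :=
  ∀ x y : P k r, algebraMap (R k) (FracR k) (ψ x y) =
    bp * φp (x : VV k).1 (y : VV k).1 + bm * φm (x : VV k).2 (y : VV k).2

/-! ### Filtrations and their type -/

/-- The filtration `B^i = {x | φ(x, B) ⊆ (T - 1) ^ i R}` that a form `φ` induces on `B`. -/
def formFiltration {B : Type*} [AddCommGroup B] [Module (R k) B]
    (φ : LinearMap.BilinForm (R k) B) (i : ℕ) : Submodule (R k) B where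
  carrier := {x | ∀ y, unif k ^ i ∣ φ x y}
  add_mem' := fun {x x'} hx hx' y => by
    rw [map_add, LinearMap.add_apply]
    exact dvd_add (hx y) (hx' y)
  zero_mem' := fun y => by simp
  smul_mem' := fun c x hx y => by
    rw [map_smul, LinearMap.smul_apply, smul_eq_mul]
    exact (hx y).mul_left c

variable (k) in
/-- The submodule `(T - 1) B`. -/
def unifMul (B : Type*) [AddCommGroup B] [Module (R k) B] : Submodule (R k) B :=
  LinearMap.range (LinearMap.lsmul (R k) B (unif k))

variable (k) in
/-- The reduction `B / (T - 1) B`. -/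
abbrev Red (B : Type*) [AddCommGroup B] [Module (R k) B] : Type _ := B ⧸ unifMul k B

/-- The action of `R ⊗ U` on the reduction. -/
def redOp {B : Type*} [AddCommGroup B] [Module (R k) B]
    (π : RU k →ₐ[R k] Module.End (R k) B) (u : RU k) : Module.End (R k) (Red k B) :=
  (unifMul k B).mapQ (unifMul k B) (π u) (by
    rintro _ ⟨y, rfl⟩
    exact ⟨π u y, by simp⟩)

/-- The image `(A + (T - 1) B) / (T - 1) B` of a submodule `A` of `B` in the reduction. -/
def redSub {B : Type*} [AddCommGroup B] [Module (R k) B] (A : Submodule (R k) B) :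
    Submodule (R k) (Red k B) :=
  A.map (unifMul k B).mkQ

/-- A submodule `S` of the reduction of `B` is isomorphic, as a module over `R ⊗ U`, to the
reduction of the Verma module `M(m + l)`. -/
def IsoVerma {B : Type*} [AddCommGroup B] [Module (R k) B]
    (π : RU k →ₐ[R k] Module.End (R k) B) (l : ℤ) (S : Submodule (R k) (Red k B)) : Prop :=
  ∃ e : Red k (ℕ →₀ R k) ≃ₗ[R k] S, ∀ (u : RU k) (x : Red k (ℕ →₀ R k)),
    (e (redOp (verma (k := k) (R k) l) u x) : Red k B) = redOp π u (e x)

/-- The filtration `A` of `B` is of type `(a, b, c)`: its image in the reduction of `B` is the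
whole reduction in degrees `i ≤ a`, is isomorphic to (the reduction of) `M(m + r)` in degrees
`a < i ≤ b` and to `M(m - r)` in degrees `b < i ≤ c`, and is zero in degrees `i > c`. -/
def HasType {B : Type*} [AddCommGroup B] [Module (R k) B]
    (π : RU k →ₐ[R k] Module.End (R k) B) (r : ℕ) (A : ℕ → Submodule (R k) B)
    (a b c : WithTop ℤ) : Prop :=
  0 ≤ a ∧ a ≤ b ∧ b ≤ c ∧ ∀ i : ℕ,
    (((i : ℤ) : WithTop ℤ) ≤ a → redSub (A i) = ⊤) ∧
    (a < ((i : ℤ) : WithTop ℤ) ∧ ((i : ℤ) : WithTop ℤ) ≤ b → IsoVerma π r (redSub (A i))) ∧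
    (b < ((i : ℤ) : WithTop ℤ) ∧ ((i : ℤ) : WithTop ℤ) ≤ c → IsoVerma π (-r) (redSub (A i))) ∧
    (c < ((i : ℤ) : WithTop ℤ) → redSub (A i) = ⊥)

end QuantumSl2
end

/-!
An invariant form on `P(m + r)` is block diagonal with blocks of size one and two, one for each
weight, and the filtration is read off from the elementary divisors of these blocks over `R`.

All computations take place in the basis `x_j = [T; 0] w_{+,j}`, `z_i = w_{+,r+i} + w_{-,i}` of
`P(m + r)`; the vectors `y_i = [T; 0] w_{-,i} = [T; 0] z_i - x_{r+i}` also lie in `P(m + r)`.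

Invariance under `ϱ` makes vectors of different weights orthogonal and multiplies the value of a
form by a fixed ratio `shapRatio` when both arguments descend one step along a Verma family
(`IsInvariantPairing.apply_succ_succ`). Hence an invariant form on `P(m + r)` is determined by its
values at `(x_r, x_r)` and `(y_0, y_0)`, the values at `(x_r, y_0)` and `(y_0, x_r)` being zero
because `E` kills `y_0` (`IsInvariantPairing.eq_zero_on_P`); this gives the existence and the
uniqueness of `b₊` and `b₋`.

The same ratios give the Shapovalov forms. With the two normalizations, `p_i = φ₊(w_{+,r+i},
w_{+,r+i})` and `m_i = φ₋(w_{-,i}, w_{-,i})` are units of `R` that are congruent modulo `T - 1`,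
while `φ₊(w_{+,j}, w_{+,j})` has order `-1` for `j < r`, since the factor `[T; 0]` enters between
`w_{+,r-1}` and `w_{+,r}`. So `b₊ φ₊ + b₋ φ₋` has order `ord b₊ + 1` at `(x_j, x_j)` for `j < r`,
and in the weight space of `x_{r+i}` and `z_i` it has the Gram matrix `([T; 0]² b₊ p_i, [T; 0] b₊
p_i; [T; 0] b₊ p_i, d_i)` with `d_i = b₊ p_i + b₋ m_i`, of determinant `[T; 0]² b₊ b₋ p_i m_i`.
Because `d_i = (b₊ + b₋) m_i + b₊ (p_i - m_i)`, there are two cases. If `ord (b₊ + b₋)` exceeds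
`ord b₊ = ord b₋`, then all entries are divisible by `(T - 1) ^ (ord b₊ + 1)` and the quotient is
unimodular (`hasType_of_ord_lt`). If `δ = ord (b₊ + b₋)` is the smaller of `ord b₊` and `ord b₋`,
then `d_i` has order `δ`, and the matrix is diagonalized with entries of orders `δ` and `ord b₊ +
ord b₋ + 2 - δ` by a correction of `x_{r+i}` by a multiple of `(T - 1) z_i` (`hasType_of_ord_le`).
The images of the filtration in the reduction are then spanned by all `x_j`, a reduced `M(m + r)`,
or by the `x_{r+i}`, which are congruent to `-y_i` and span a reduced `M(m - r)`.
-/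

noncomputable section

namespace QuantumSl2

variable {k : Type*} [Field k]

/-! ### The order at `T - 1` -/

theorem ord_zero : ord (0 : FracR k) = ⊤ := by simp [ord]

theorem ord_eq_top {a : FracR k} : ord a = ⊤ ↔ a = 0 := by
  rw [ord, HahnSeries.orderTop_eq_top, EmbeddingLike.map_eq_zero_iff]

theorem ord_mul (a b : FracR k) : ord (a * b) = ord a + ord b := by
  rcases eq_or_ne a 0 with rfl | ha
  · simp [ord_zero]
  rcases eq_or_ne b 0 with rfl | hb
  · simp [ord_zero]
  rw [ord, map_mul, HahnSeries.orderTop_mul_of_ne_zero]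
  · rfl
  · refine mul_ne_zero ?_ ?_ <;>
      rwa [Ne, HahnSeries.leadingCoeff_eq_zero, EmbeddingLike.map_eq_zero_iff]

theorem ord_neg (a : FracR k) : ord (-a) = ord a := by
  rw [ord, map_neg, HahnSeries.orderTop_neg]
  rfl

theorem le_ord_add {n : WithTop ℤ} {a b : FracR k} (ha : n ≤ ord a) (hb : n ≤ ord b) :
    n ≤ ord (a + b) := by
  rw [ord, map_add]
  exact (le_min ha hb).trans HahnSeries.min_orderTop_le_orderTop_add

theorem le_ord_sub {n : WithTop ℤ} {a b : FracR k} (ha : n ≤ ord a) (hb : n ≤ ord b) :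
    n ≤ ord (a - b) := by
  rw [sub_eq_add_neg]
  exact le_ord_add ha (by rwa [ord_neg])

theorem ord_add_eq_left {a b : FracR k} (h : ord a < ord b) : ord (a + b) = ord a := by
  rw [ord, map_add, HahnSeries.orderTop_add_eq_left h]
  rfl

theorem ord_algebraMap (a : R k) : ord (algebraMap (R k) (FracR k) a)
    = HahnSeries.orderTop (HahnSeries.ofPowerSeries ℤ (Kv k) a) := by
  rw [ord, AlgEquiv.commutes]
  rfl

theorem ord_algebraMap_nonneg (a : R k) : 0 ≤ ord (algebraMap (R k) (FracR k) a) := by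
  rw [ord_algebraMap, HahnSeries.le_orderTop_iff_forall]
  intro j hj
  rw [PowerSeries.coeff_coe, if_pos (by exact_mod_cast hj)]

theorem ord_algebraMap_of_isUnit {a : R k} (ha : IsUnit a) :
    ord (algebraMap (R k) (FracR k) a) = 0 := by
  obtain ⟨b, hab⟩ := ha.exists_right_inv
  have h : ord (algebraMap (R k) (FracR k) a) + ord (algebraMap (R k) (FracR k) b) = 0 := by
    rw [← ord_mul, ← map_mul, hab, ord_algebraMap, map_one, HahnSeries.orderTop_one]
  have h1 := ord_algebraMap_nonneg a
  have h2 := ord_algebraMap_nonneg b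
  exact ((add_eq_zero_iff_of_nonneg h1 h2).mp h).1

theorem ord_unif : ord (algebraMap (R k) (FracR k) (unif k)) = 1 := by
  rw [ord_algebraMap, unif, PowerSeries.coe_X, HahnSeries.orderTop_single one_ne_zero]
  rfl

theorem ord_unif_pow_mul {u : R k} (hu : IsUnit u) (n : ℕ) :
    ord (algebraMap (R k) (FracR k) (unif k ^ n * u)) = (n : ℤ) := by
  rw [map_mul, ord_mul, ord_algebraMap_of_isUnit hu, add_zero]
  induction n with
  | zero => simpa using ord_algebraMap_of_isUnit (k := k) isUnit_one
  | succ n ih =>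
    rw [pow_succ, map_mul, ord_mul, ih, ord_unif]
    push_cast
    rfl

theorem exists_eq_unif_pow_mul {a : R k} (ha : a ≠ 0) :
    ∃ (n : ℕ) (u : R k), IsUnit u ∧ a = unif k ^ n * u := by
  obtain ⟨n, u, hu⟩ := IsDiscreteValuationRing.eq_unit_mul_pow_irreducible ha
    (PowerSeries.X_prime (R := Kv k)).irreducible
  exact ⟨n, u, u.isUnit, by rw [hu, mul_comm]; rfl⟩

/-- An element of nonnegative order lies in `R`. -/
theorem exists_algebraMap_eq {f : FracR k} (hf : 0 ≤ ord f) :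
    ∃ a : R k, algebraMap (R k) (FracR k) a = f := by
  obtain ⟨a, b, hb, rfl⟩ := IsFractionRing.div_surjective (A := R k) f
  have hb0 : b ≠ 0 := nonZeroDivisors.ne_zero hb
  rcases eq_or_ne a 0 with rfl | ha
  · exact ⟨0, by simp⟩
  obtain ⟨n, u, hu, rfl⟩ := exists_eq_unif_pow_mul ha
  obtain ⟨m, w, hw, rfl⟩ := exists_eq_unif_pow_mul hb0
  have hinj := FaithfulSMul.algebraMap_injective (R k) (FracR k)
  have hne : algebraMap (R k) (FracR k) (unif k ^ m * w) ≠ 0 := by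
    rwa [Ne, map_eq_zero_iff _ hinj]
  have h : ord (algebraMap (R k) (FracR k) (unif k ^ m * w))
      ≤ ord (algebraMap (R k) (FracR k) (unif k ^ n * u)) := by
    conv_rhs => rw [← div_mul_cancel₀ (algebraMap (R k) (FracR k) (unif k ^ n * u)) hne, ord_mul]
    exact le_add_of_nonneg_left hf
  rw [ord_unif_pow_mul hu, ord_unif_pow_mul hw] at h
  have hmn : m ≤ n := by exact_mod_cast h
  obtain ⟨w', hw'⟩ := hw.exists_right_inv
  refine ⟨unif k ^ (n - m) * u * w', ?_⟩
  rw [eq_div_iff hne, ← map_mul]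
  congr 1
  calc unif k ^ (n - m) * u * w' * (unif k ^ m * w)
      = unif k ^ (n - m) * unif k ^ m * u * (w * w') := by ring
    _ = unif k ^ n * u := by rw [← pow_add, Nat.sub_add_cancel hmn, hw', mul_one]

theorem unif_pow_dvd_iff {a : R k} {n : ℕ} :
    unif k ^ n ∣ a ↔ ((n : ℤ) : WithTop ℤ) ≤ ord (algebraMap (R k) (FracR k) a) := by
  constructor
  · rintro ⟨b, rfl⟩
    rw [map_mul, ord_mul]
    have := ord_unif_pow_mul (k := k) isUnit_one n
    rw [mul_one] at this
    rw [this]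
    exact le_add_of_nonneg_right (ord_algebraMap_nonneg b)
  · intro h
    rcases eq_or_ne a 0 with rfl | ha
    · exact dvd_zero _
    obtain ⟨m, u, hu, rfl⟩ := exists_eq_unif_pow_mul ha
    rw [ord_unif_pow_mul hu] at h
    exact (pow_dvd_pow _ (by exact_mod_cast h)).mul_right u

theorem unif_dvd_iff {a : R k} :
    unif k ∣ a ↔ 1 ≤ ord (algebraMap (R k) (FracR k) a) := by
  simpa using unif_pow_dvd_iff (a := a) (n := 1)

theorem unif_ne_zero : unif k ≠ 0 := PowerSeries.X_ne_zero

/-! ### Quantum integers -/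

theorem v_ne_zero : v k ≠ 0 := RatFunc.X_ne_zero

theorem v_pow_ne_one {n : ℕ} (hn : n ≠ 0) : v k ^ n ≠ 1 := by
  intro h
  have h3 : (algebraMap (Polynomial k) (Kv k)) (Polynomial.X ^ n) = algebraMap _ _ 1 := by
    simpa [v, RatFunc.algebraMap_X] using h
  have h4 := congrArg (fun p => Polynomial.coeff p 0) (RatFunc.algebraMap_injective k h3)
  simp [Polynomial.coeff_X_pow, hn.symm] at h4

theorem v_zpow_ne_one {n : ℤ} (hn : n ≠ 0) : v k ^ n ≠ 1 := by
  intro h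
  refine v_pow_ne_one (k := k) (n := n.natAbs) (by omega) ?_
  rcases Int.natAbs_eq n with e | e <;> rw [e] at h
  · rwa [zpow_natCast] at h
  · rwa [zpow_neg, inv_eq_one, zpow_natCast] at h

theorem v_zpow_injective : Function.Injective (fun n : ℤ => v k ^ n) := by
  intro m n h
  by_contra hne
  refine v_zpow_ne_one (k := k) (sub_ne_zero.mpr hne) ?_
  rw [zpow_sub₀ v_ne_zero, show v k ^ m = v k ^ n from h]
  exact div_self (zpow_ne_zero _ v_ne_zero)

theorem qInt_ne_zero {m : ℤ} (hm : m ≠ 0) : qInt k m ≠ 0 := by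
  refine div_ne_zero (sub_ne_zero.mpr fun h => hm ?_) v_sub_ne
  have := v_zpow_injective h
  omega

theorem isUnit_smul {c : Kv k} (hc : c ≠ 0) {a : R k} (ha : IsUnit a) : IsUnit (c • a) := by
  rw [PowerSeries.smul_eq_C_mul]
  exact ((isUnit_iff_ne_zero.mpr hc).map PowerSeries.C).mul ha

theorem isUnit_T : IsUnit (T k) := IsUnit.of_mul_eq_one _ T_mul_inv

theorem isUnit_T_inv : IsUnit (T k)⁻¹ := IsUnit.of_mul_eq_one _ (by rw [mul_comm, T_mul_inv])

theorem constantCoeff_T : PowerSeries.constantCoeff (T k) = 1 := by simp [T, unif]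

theorem isUnit_qT {m : ℤ} (hm : m ≠ 0) : IsUnit (qT k m) := by
  rw [PowerSeries.isUnit_iff_constantCoeff, isUnit_iff_ne_zero]
  have h : PowerSeries.constantCoeff (qT k m) = qInt k m := by
    simp only [qT, qInt, PowerSeries.constantCoeff_smul, map_sub, PowerSeries.constantCoeff_inv,
      constantCoeff_T, smul_eq_mul, inv_one, mul_one]
    rw [div_eq_inv_mul]
  rw [h]
  exact qInt_ne_zero hm

/-- `[T; 0] = (T - 1) (T + 1) T⁻¹ / (v - v⁻¹)` generates the maximal ideal; the factor `T + 1` is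
a unit since `2 ≠ 0`. -/
theorem qT_zero_eq [CharZero k] : ∃ u : R k, IsUnit u ∧ qT k 0 = unif k * u := by
  refine ⟨(v k - (v k)⁻¹)⁻¹ • ((T k + 1) * (T k)⁻¹),
    isUnit_smul (inv_ne_zero v_sub_ne) (IsUnit.mul ?_ isUnit_T_inv), ?_⟩
  · rw [PowerSeries.isUnit_iff_constantCoeff, map_add, constantCoeff_T, map_one,
      isUnit_iff_ne_zero, one_add_one_eq_two]
    have : CharZero (Kv k) :=
      charZero_of_injective_algebraMap (algebraMap k (RatFunc k)).injective
    exact two_ne_zero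
  · rw [qT, mul_smul_comm]
    congr 1
    have h := T_mul_inv (k := k)
    have e : unif k = T k - 1 := by simp [T]
    rw [neg_zero, zpow_zero, one_smul, one_smul, e]
    linear_combination (-(T k)) * h

theorem ord_qT_zero [CharZero k] : ord (algebraMap (R k) (FracR k) (qT k 0)) = 1 := by
  obtain ⟨u, hu, h⟩ := qT_zero_eq (k := k)
  simpa [h] using ord_unif_pow_mul hu 1

/-! ### Homomorphisms and invariant pairings -/

section Pairing

variable {N N' : Type*} [AddCommGroup N] [Module (R k) N] [AddCommGroup N'] [Module (R k) N']
  (π : RU k →ₐ[R k] Module.End (R k) N) (π' : RU k →ₐ[R k] Module.End (R k) N')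

/-- A linear map that commutes with the generators of `U` commutes with `R ⊗ U`, since its graph is
a submodule of the direct sum. -/
theorem intertwine_of_gen (f : N →ₗ[R k] N')
    (h : ∀ g x, f (π (inU (gen k g)) x) = π' (inU (gen k g)) (f x)) (u : RU k) (x : N) :
    f (π u x) = π' u (f x) := by
  have hs := stable_of_gen (prodRep π π') f.graph (by
    rintro g ⟨x, y⟩ hxy
    obtain rfl : y = f x := hxy
    exact (h g x).symm)
  exact (hs u (x, f x) rfl).symm

/-- A family of vectors on which the generators of `U` act as on the basis `w_j` of the Verma module
of highest weight `T v ^ (l - 1)`. -/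
structure IsVermaFamily (l : ℤ) (w : ℕ → N) : Prop where
  E_apply : ∀ j : ℕ, π (inU (gen k Gen.E)) (w j) = (qInt k j • qT k (l - j)) • w (j - 1)
  F_apply : ∀ j : ℕ, π (inU (gen k Gen.F)) (w j) = w (j + 1)
  K_apply : ∀ j : ℕ, π (inU (gen k Gen.K)) (w j) = (v k ^ (l - 1 - 2 * j) • T k) • w j
  Kinv_apply : ∀ j : ℕ,
    π (inU (gen k Gen.Kinv)) (w j) = (v k ^ (-(l - 1 - 2 * j)) • (T k)⁻¹) • w j

/-- Invariance under `ϱ` of an `R`-bilinear pairing with values in the fraction field of `R`. -/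
def IsInvariantPairing (B : N →ₗ[R k] N →ₗ[R k] FracR k) : Prop :=
  ∀ (u : U k) (a b : N), B (π (inU u) a) b = B a (π (inU (antiAut k u).unop) b)

variable {π π'}

theorem IsVermaFamily.map {l : ℤ} {w : ℕ → N} (hw : IsVermaFamily π l w) (f : N →ₗ[R k] N')
    (hf : ∀ g x, f (π (inU (gen k g)) x) = π' (inU (gen k g)) (f x)) :
    IsVermaFamily π' l (fun j => f (w j)) where
  E_apply j := by rw [← hf, hw.E_apply, map_smul]
  F_apply j := by rw [← hf, hw.F_apply]
  K_apply j := by rw [← hf, hw.K_apply, map_smul]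
  Kinv_apply j := by rw [← hf, hw.Kinv_apply, map_smul]

theorem inU_smul (c : Kv k) (u : U k) : inU (c • u) = algebraMap (Kv k) (R k) c • inU u := by
  rw [inU, TensorProduct.tmul_smul, algebraMap_smul]
  rfl

theorem inU_mul (a b : U k) : inU (a * b) = inU a * inU b := by simp [inU]

/-- The ratio `φ(w_{j+1}, w_{j+1}) / φ(w_j, w_j)` of consecutive values of an invariant form on the
Verma module of highest weight `T v ^ (l - 1)`. -/
def shapRatio (k : Type*) [Field k] (l : ℤ) (j : ℕ) : R k :=
  (v k • (v k ^ (-(l - 1 - 2 * j)) • (T k)⁻¹)) *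
    (qInt k ((j : ℤ) + 1) • qT k (l - ((j : ℤ) + 1)))

variable {B : N →ₗ[R k] N →ₗ[R k] FracR k}

theorem IsInvariantPairing.F_left (hB : IsInvariantPairing π B) (a b : N) :
    B (π (inU (gen k Gen.F)) a) b
      = algebraMap (Kv k) (R k) (v k) •
        B a (π (inU (gen k Gen.Kinv)) (π (inU (gen k Gen.E)) b)) := by
  have h : (antiAut k (gen k Gen.F)).unop = v k • (gen k Gen.Kinv * gen k Gen.E) := by
    rw [antiAut, liftU_gen]
    rfl
  rw [hB, h, inU_smul, inU_mul, map_smul, map_mul, LinearMap.smul_apply, map_smul,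
    Module.End.mul_apply]

theorem IsInvariantPairing.K_left (hB : IsInvariantPairing π B) (a b : N) :
    B (π (inU (gen k Gen.K)) a) b = B a (π (inU (gen k Gen.K)) b) := by
  have h : (antiAut k (gen k Gen.K)).unop = gen k Gen.K := by
    rw [antiAut, liftU_gen]
    rfl
  rw [hB, h]

/-- Vectors of different weights are orthogonal, because `v` is not a root of unity. -/
theorem IsInvariantPairing.eq_zero_of_weight_ne (hB : IsInvariantPairing π B) {l l' : ℤ}
    {w w' : ℕ → N} (hw : IsVermaFamily π l w) (hw' : IsVermaFamily π l' w') {i j : ℕ}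
    (hij : l - 2 * i ≠ l' - 2 * j) : B (w i) (w' j) = 0 := by
  have h := hB.K_left (w i) (w' j)
  rw [hw.K_apply, hw'.K_apply, map_smul, LinearMap.smul_apply, map_smul, ← sub_eq_zero,
    ← sub_smul, ← sub_smul] at h
  refine (smul_eq_zero_iff_right (IsUnit.ne_zero (isUnit_smul ?_ isUnit_T))).mp h
  intro h0
  have := v_zpow_injective (sub_eq_zero.mp h0)
  omega

theorem IsInvariantPairing.apply_succ_succ (hB : IsInvariantPairing π B) {l l' : ℤ}
    {w w' : ℕ → N} (hw : IsVermaFamily π l w) (hw' : IsVermaFamily π l' w') (i j : ℕ) :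
    B (w (i + 1)) (w' (j + 1)) = shapRatio k l' j • B (w i) (w' j) := by
  rw [← hw.F_apply, hB.F_left, hw'.E_apply, map_smul, Nat.add_sub_cancel, hw'.Kinv_apply,
    ← map_smul, smul_smul, smul_smul, map_smul, shapRatio, Algebra.smul_def (v k)]
  congr 1
  push_cast
  ring

theorem IsInvariantPairing.apply_succ_zero (hB : IsInvariantPairing π B) {l l' : ℤ}
    {w w' : ℕ → N} (hw : IsVermaFamily π l w) (hw' : IsVermaFamily π l' w') (i : ℕ) :
    B (w (i + 1)) (w' 0) = 0 := by
  rw [← hw.F_apply, hB.F_left, hw'.E_apply]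
  simp [qInt]

theorem IsInvariantPairing.apply_zero_succ (hB : IsInvariantPairing π B) {l l' : ℤ}
    {w w' : ℕ → N} (hw : IsVermaFamily π l w) (hw' : IsVermaFamily π l' w') (i : ℕ) :
    B (w 0) (w' (i + 1)) = 0 := by
  have h : (antiAut k (gen k Gen.E)).unop = v k • (gen k Gen.K * gen k Gen.F) := by
    rw [antiAut, liftU_gen]
    rfl
  have h1 := hB (gen k Gen.E) (w 0) (w' i)
  rw [h, inU_smul, inU_mul, map_smul, map_mul, LinearMap.smul_apply, Module.End.mul_apply,
    hw'.F_apply, hw'.K_apply, smul_smul, map_smul, hw.E_apply] at h1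
  have h2 : qInt k ((0 : ℕ) : ℤ) = 0 := by simp [qInt]
  rw [h2, zero_smul, zero_smul, map_zero, LinearMap.zero_apply, ← Algebra.smul_def] at h1
  exact (smul_eq_zero_iff_right
    (isUnit_smul v_ne_zero (isUnit_smul (zpow_ne_zero _ v_ne_zero) isUnit_T)).ne_zero).mp h1.symm

/-- Two vectors of equal weight pair to a multiple of the pairing of the vectors that lie `n` steps
higher. -/
theorem IsInvariantPairing.apply_add_add (hB : IsInvariantPairing π B) {l l' : ℤ}
    {w w' : ℕ → N} (hw : IsVermaFamily π l w) (hw' : IsVermaFamily π l' w') (i j n : ℕ) :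
    B (w (i + n)) (w' (j + n))
      = (∏ m ∈ Finset.range n, shapRatio k l' (j + m)) • B (w i) (w' j) := by
  induction n with
  | zero => simp
  | succ n ih =>
    rw [← add_assoc, ← add_assoc, hB.apply_succ_succ hw hw', ih, smul_smul,
      Finset.prod_range_succ, mul_comm]

end Pairing

theorem isUnit_shapRatio {l : ℤ} {j : ℕ} (h : l ≠ j + 1) : IsUnit (shapRatio k l j) := by
  refine IsUnit.mul (isUnit_smul v_ne_zero (isUnit_smul (zpow_ne_zero _ v_ne_zero) isUnit_T_inv))
    (isUnit_smul (qInt_ne_zero (by omega)) (isUnit_qT (sub_ne_zero.mpr h)))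

theorem ord_shapRatio_self [CharZero k] (r : ℕ) :
    ord (algebraMap (R k) (FracR k) (shapRatio k ((r : ℤ) + 1) r)) = 1 := by
  rw [shapRatio, sub_self, mul_smul_comm, ← smul_mul_assoc, map_mul, ord_mul, ord_qT_zero,
    ord_algebraMap_of_isUnit, zero_add]
  exact isUnit_smul (qInt_ne_zero (by omega))
    (isUnit_smul v_ne_zero (isUnit_smul (zpow_ne_zero _ v_ne_zero) isUnit_T_inv))

/-- The two Verma modules have congruent ratios in equal weights. -/
theorem unif_dvd_shapRatio_sub [CharZero k] (r j : ℕ) :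
    unif k ∣ shapRatio k r (r + j) - shapRatio k (-r) j := by
  have h := add_scalar (k := k) r ((j : ℤ) + 1)
  have e1 : (r : ℤ) - 1 - 2 * ((r + j : ℕ) : ℤ) = -r - 1 - 2 * j := by push_cast; ring
  have e2 : ((r + j : ℕ) : ℤ) + 1 = r + (j + 1) := by push_cast; ring
  have e3 : (r : ℤ) - (r + ((j : ℤ) + 1)) = -(j + 1) := by ring
  obtain ⟨u, -, hu⟩ := qT_zero_eq (k := k)
  rw [shapRatio, shapRatio, e1, e2, e3, h, ← mul_sub, add_sub_cancel_left, hu, ← mul_smul_comm]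
  exact (dvd_mul_right _ _).mul_left _

/-! ### Verma families in the Verma modules and in `P(m + r)` -/

theorem isVermaFamily_verma (S : Type*) [CommRing S] [Algebra (R k) S] [Module (Kv k) S]
    [IsScalarTower (Kv k) (R k) S] (l : ℤ) :
    IsVermaFamily (verma (k := k) S l) l (fun j => Finsupp.single j (1 : S)) where
  E_apply j := by
    rw [verma_gen]
    exact (wOp_single S _ _ j 1).trans (Finsupp.smul_single _ _ _).symm
  F_apply j := by
    rw [verma_gen]
    exact (wOp_single S _ _ j 1).trans (by rw [one_smul])
  K_apply j := by
    rw [verma_gen]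
    exact (wOp_single S _ _ j 1).trans (Finsupp.smul_single _ _ _).symm
  Kinv_apply j := by
    rw [verma_gen]
    exact (wOp_single S _ _ j 1).trans (Finsupp.smul_single _ _ _).symm

/-- A Verma family is the same as a homomorphism out of the Verma module over `R`. -/
theorem IsVermaFamily.linearCombination_apply {N : Type*} [AddCommGroup N] [Module (R k) N]
    {π : RU k →ₐ[R k] Module.End (R k) N} {l : ℤ} {w : ℕ → N} (hw : IsVermaFamily π l w)
    (u : RU k) (x : ℕ →₀ R k) :
    Finsupp.linearCombination (R k) w (verma (k := k) (R k) l u x)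
      = π u (Finsupp.linearCombination (R k) w x) := by
  refine intertwine_of_gen _ _ _ (fun g x => ?_) u x
  have hs := isVermaFamily_verma (k := k) (R k) l
  suffices h : Finsupp.linearCombination (R k) w ∘ₗ verma (k := k) (R k) l (inU (gen k g))
      = π (inU (gen k g)) ∘ₗ Finsupp.linearCombination (R k) w from LinearMap.congr_fun h x
  refine Finsupp.lhom_ext' fun j => LinearMap.ext_ring ?_
  simp only [LinearMap.comp_apply, Finsupp.lsingle_apply, Finsupp.linearCombination_single,
    one_smul]
  cases g
  · rw [hs.E_apply, hw.E_apply, map_smul, Finsupp.linearCombination_single, one_smul]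
  · rw [hs.F_apply, hw.F_apply, Finsupp.linearCombination_single, one_smul]
  · rw [hs.K_apply, hw.K_apply, map_smul, Finsupp.linearCombination_single, one_smul]
  · rw [hs.Kinv_apply, hw.Kinv_apply, map_smul, Finsupp.linearCombination_single, one_smul]

section

variable (k) (r : ℕ)

/-- The basis vector `[T; 0] w_{+,j}` of `P(m + r)`. -/
def xP (j : ℕ) : P k r := ⟨qT k 0 • wPlus k j, Submodule.subset_span (Or.inl ⟨j, rfl⟩)⟩

/-- The basis vector `w_{+,r+j} + w_{-,j}` of `P(m + r)`. -/
def zP (j : ℕ) : P k r :=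
  ⟨wPlus k (r + j) + wMinus k j, Submodule.subset_span (Or.inr ⟨j, rfl⟩)⟩

/-- The vector `[T; 0] w_{-,j}` of `P(m + r)`. -/
def yP (j : ℕ) : P k r := ⟨qT k 0 • wMinus k j, by
  have h : qT k 0 • wMinus k j = qT k 0 • (zP k r j : VV k) - xP k r (r + j) := by
    change _ = qT k 0 • (wPlus k (r + j) + wMinus k j) - qT k 0 • wPlus k (r + j)
    rw [smul_add, add_sub_cancel_left]
  rw [h]
  exact sub_mem (Submodule.smul_mem _ _ (zP k r j).2) (xP k r (r + j)).2⟩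

theorem smul_zP (j : ℕ) : qT k 0 • zP k r j = yP k r j + xP k r (r + j) :=
  Subtype.ext ((smul_add _ _ _).trans (add_comm _ _))

theorem isVermaFamily_xP : IsVermaFamily (repP k r) r (xP k r) := by
  have h := (isVermaFamily_verma (k := k) (FracR k) r).map (π' := repVV k r)
    (qT k 0 • LinearMap.inl (R k) (ℕ →₀ FracR k) (ℕ →₀ FracR k)) (fun g x => by
      rw [LinearMap.smul_apply, LinearMap.smul_apply, map_smul, repVV_gen, verma_gen]
      simp only [LinearMap.inl_apply, map_zero])
  exact ⟨fun j => Subtype.ext (h.E_apply j), fun j => Subtype.ext (h.F_apply j),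
    fun j => Subtype.ext (h.K_apply j), fun j => Subtype.ext (h.Kinv_apply j)⟩

theorem isVermaFamily_yP : IsVermaFamily (repP k r) (-r) (yP k r) := by
  have h := (isVermaFamily_verma (k := k) (FracR k) (-r)).map (π' := repVV k r)
    (qT k 0 • LinearMap.inr (R k) (ℕ →₀ FracR k) (ℕ →₀ FracR k)) (fun g x => by
      rw [LinearMap.smul_apply, LinearMap.smul_apply, map_smul, repVV_gen, verma_gen]
      simp only [LinearMap.inr_apply, map_zero])
  exact ⟨fun j => Subtype.ext (h.E_apply j), fun j => Subtype.ext (h.F_apply j),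
    fun j => Subtype.ext (h.K_apply j), fun j => Subtype.ext (h.Kinv_apply j)⟩

end

section

variable {r : ℕ}

theorem P_submodule_eq_top {Q : Submodule (R k) (P k r)} (hx : ∀ j, xP k r j ∈ Q)
    (hz : ∀ j, zP k r j ∈ Q) : Q = ⊤ := by
  have h : P k r ≤ Q.map (P k r).subtype := by
    refine Submodule.span_le.mpr ?_
    rintro _ (⟨j, rfl⟩ | ⟨j, rfl⟩)
    · exact ⟨_, hx j, rfl⟩
    · exact ⟨_, hz j, rfl⟩
  refine eq_top_iff.mpr fun x _ => ?_
  obtain ⟨y, hy, hyx⟩ := h x.2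
  rwa [← Subtype.ext hyx]

theorem P_hom_ext {M : Type*} [AddCommGroup M] [Module (R k) M] {f g : P k r →ₗ[R k] M}
    (hx : ∀ j, f (xP k r j) = g (xP k r j)) (hz : ∀ j, f (zP k r j) = g (zP k r j)) : f = g := by
  have h := P_submodule_eq_top (Q := LinearMap.eqLocus f g) hx hz
  exact LinearMap.eqLocus_eq_top.mp h

theorem P_exists_coords (x : P k r) : ∃ a c : ℕ →₀ R k,
    x = Finsupp.linearCombination (R k) (xP k r) a
      + Finsupp.linearCombination (R k) (zP k r) c := by
  have h : LinearMap.range (Finsupp.linearCombination (R k) (xP k r)) ⊔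
      LinearMap.range (Finsupp.linearCombination (R k) (zP k r)) = ⊤ :=
    P_submodule_eq_top
      (fun j => Submodule.mem_sup_left ⟨Finsupp.single j 1, by simp⟩)
      (fun j => Submodule.mem_sup_right ⟨Finsupp.single j 1, by simp⟩)
  obtain ⟨_, ⟨a, rfl⟩, _, ⟨c, rfl⟩, hx⟩ := Submodule.mem_sup.mp (h.ge (Submodule.mem_top (x := x)))
  exact ⟨a, c, hx.symm⟩

theorem linearCombination_xP_snd (a : ℕ →₀ R k) :
    (Finsupp.linearCombination (R k) (xP k r) a : VV k).2 = 0 := by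
  induction a using Finsupp.induction_linear with
  | zero => simp
  | add a b ha hb => rw [map_add, Submodule.coe_add, Prod.snd_add, ha, hb, add_zero]
  | single j s => simp [xP, wPlus]

theorem linearCombination_xP_fst (a : ℕ →₀ R k) (j : ℕ) :
    (Finsupp.linearCombination (R k) (xP k r) a : VV k).1 j
      = algebraMap (R k) (FracR k) (qT k 0 * a j) := by
  induction a using Finsupp.induction_linear with
  | zero => simp
  | add a b ha hb =>
    rw [map_add, Submodule.coe_add, Prod.fst_add, Finsupp.add_apply, ha, hb, Finsupp.add_apply,
      mul_add, map_add]
  | single i s =>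
    rw [Finsupp.linearCombination_single]
    change (s • qT k 0 • Finsupp.single i (1 : FracR k)) j = _
    by_cases h : i = j
    · subst h
      simp [Algebra.smul_def, mul_comm]
    · simp [h]

theorem linearCombination_zP_snd (c : ℕ →₀ R k) (i : ℕ) :
    (Finsupp.linearCombination (R k) (zP k r) c : VV k).2 i
      = algebraMap (R k) (FracR k) (c i) := by
  induction c using Finsupp.induction_linear with
  | zero => simp
  | add a b ha hb =>
    rw [map_add, Submodule.coe_add, Prod.snd_add, Finsupp.add_apply, ha, hb, Finsupp.add_apply,
      map_add]
  | single j s =>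
    rw [Finsupp.linearCombination_single]
    change (s • (0 + Finsupp.single j (1 : FracR k))) i = _
    by_cases h : j = i
    · subst h
      simp [Algebra.smul_def]
    · simp [h]

theorem linearCombination_zP_fst_add (c : ℕ →₀ R k) (i : ℕ) :
    (Finsupp.linearCombination (R k) (zP k r) c : VV k).1 (r + i)
      = algebraMap (R k) (FracR k) (c i) := by
  induction c using Finsupp.induction_linear with
  | zero => simp
  | add a b ha hb =>
    rw [map_add (Finsupp.linearCombination (R k) (zP k r)), Submodule.coe_add, Prod.fst_add,
      Finsupp.add_apply, ha, hb, Finsupp.add_apply, map_add]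
  | single j s =>
    rw [Finsupp.linearCombination_single]
    change (s • (Finsupp.single (r + j) (1 : FracR k) + 0)) (r + i) = _
    by_cases h : j = i
    · subst h
      simp [Algebra.smul_def]
    · simp [h]

theorem linearCombination_zP_fst_of_lt (c : ℕ →₀ R k) {j : ℕ} (hj : j < r) :
    (Finsupp.linearCombination (R k) (zP k r) c : VV k).1 j = 0 := by
  induction c using Finsupp.induction_linear with
  | zero => simp
  | add a b ha hb => rw [map_add, Submodule.coe_add, Prod.fst_add, Finsupp.add_apply, ha, hb,
      add_zero]
  | single i s =>
    rw [Finsupp.linearCombination_single]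
    change (s • (Finsupp.single (r + i) (1 : FracR k) + 0)) j = _
    simp [show r + i ≠ j by omega]

theorem qT_zero_ne_zero [CharZero k] : qT k 0 ≠ 0 := by
  obtain ⟨u, hu, h⟩ := qT_zero_eq (k := k)
  rw [h]
  exact mul_ne_zero unif_ne_zero hu.ne_zero

theorem shapRatio_ne_zero [CharZero k] (l : ℤ) (j : ℕ) : shapRatio k l j ≠ 0 := by
  by_cases h : l = j + 1
  · subst h
    rw [shapRatio, sub_self, mul_smul_comm, ← smul_mul_assoc]
    exact mul_ne_zero (isUnit_smul (qInt_ne_zero (by omega)) (isUnit_smul v_ne_zero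
      (isUnit_smul (zpow_ne_zero _ v_ne_zero) isUnit_T_inv))).ne_zero qT_zero_ne_zero
  · exact (isUnit_shapRatio h).ne_zero

/-- On a torsion-free target it suffices to test on the vectors `x_j` and `y_j`, because
`[T; 0] z_j = y_j + x_{r+j}`. -/
theorem P_hom_eq_zero [CharZero k] {M : Type*} [AddCommGroup M] [Module (R k) M]
    [Module.IsTorsionFree (R k) M] {f : P k r →ₗ[R k] M} (hx : ∀ j, f (xP k r j) = 0)
    (hy : ∀ j, f (yP k r j) = 0) : f = 0 := by
  refine P_hom_ext hx fun j => ?_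
  have h : qT k 0 • f (zP k r j) = 0 := by
    rw [← map_smul, smul_zP, map_add, hx, hy, add_zero]
  exact (smul_eq_zero_iff_right qT_zero_ne_zero).mp h

/-- An invariant pairing on `P(m + r)` is determined by its values on `[T; 0] w_{+,r}` and
`[T; 0] w_{-,0}`. -/
theorem IsInvariantPairing.eq_zero_on_P [CharZero k] (hr : 0 < r)
    {B : P k r →ₗ[R k] P k r →ₗ[R k] FracR k} (hB : IsInvariantPairing (N := P k r) (repP k r) B)
    (hx : B (xP k r r) (xP k r r) = 0)
    (hy : B (yP k r 0) (yP k r 0) = 0) : B = 0 := by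
  have hX := isVermaFamily_xP k r
  have hY := isVermaFamily_yP k r
  have hxx : ∀ i j, B (xP k r i) (xP k r j) = 0 := by
    intro i j
    by_cases hij : i = j
    · subst hij
      rcases le_total r i with h | h
      · obtain ⟨n, rfl⟩ := Nat.exists_eq_add_of_le h
        rw [hB.apply_add_add hX hX, hx, smul_zero]
      · obtain ⟨n, hn⟩ := Nat.exists_eq_add_of_le h
        have h1 := hB.apply_add_add hX hX i i n
        rw [← hn, hx] at h1
        exact (smul_eq_zero_iff_right
          (Finset.prod_ne_zero_iff.mpr fun m _ => shapRatio_ne_zero _ _)).mp h1.symm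
    · exact hB.eq_zero_of_weight_ne hX hX (by omega)
  have hyy : ∀ i j, B (yP k r i) (yP k r j) = 0 := by
    intro i j
    by_cases hij : i = j
    · subst hij
      have h1 := hB.apply_add_add hY hY 0 0 i
      rwa [hy, smul_zero, zero_add] at h1
    · exact hB.eq_zero_of_weight_ne hY hY (by omega)
  obtain ⟨s, rfl⟩ : ∃ s, r = s + 1 := ⟨r - 1, by omega⟩
  have hxy : ∀ i j, B (xP k (s + 1) i) (yP k (s + 1) j) = 0 := by
    intro i j
    by_cases hij : i = s + 1 + j
    · subst hij
      have h1 := hB.apply_add_add hX hY (s + 1) 0 j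
      rwa [hB.apply_succ_zero hX hY, smul_zero, zero_add] at h1
    · exact hB.eq_zero_of_weight_ne hX hY (by omega)
  have hyx : ∀ i j, B (yP k (s + 1) j) (xP k (s + 1) i) = 0 := by
    intro i j
    by_cases hij : i = s + 1 + j
    · subst hij
      have h1 := hB.apply_add_add hY hX 0 (s + 1) j
      rwa [hB.apply_zero_succ hY hX, smul_zero, zero_add] at h1
    · exact hB.eq_zero_of_weight_ne hY hX (by omega)
  exact P_hom_eq_zero (fun i => P_hom_eq_zero (hxx i) (hxy i))
    (fun i => P_hom_eq_zero (fun j => hyx j i) (hyy i))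

end

/-! ### Invariant forms on `P(m + r)` as combinations of Shapovalov forms -/

section

variable {r : ℕ} (φp φm : LinearMap.BilinForm (FracR k) (ℕ →₀ FracR k)) (bp bm : FracR k)

/-- The pairing `b₊ φ₊ + b₋ φ₋` on `P(m + r)`. -/
def combination (r : ℕ) : P k r →ₗ[R k] P k r →ₗ[R k] FracR k :=
  LinearMap.mk₂ (R k)
    (fun x y => bp * φp (x : VV k).1 (y : VV k).1 + bm * φm (x : VV k).2 (y : VV k).2)
    (fun x x' y => by
      simp only [Submodule.coe_add, Prod.fst_add, Prod.snd_add, map_add, LinearMap.add_apply]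
      ring)
    (fun c x y => by
      simp only [Submodule.coe_smul, Prod.smul_fst, Prod.smul_snd,
        LinearMap.map_smul_of_tower, LinearMap.smul_apply, smul_add, mul_smul_comm])
    (fun x y y' => by
      simp only [Submodule.coe_add, Prod.fst_add, Prod.snd_add, map_add]
      ring)
    (fun c x y => by
      simp only [Submodule.coe_smul, Prod.smul_fst, Prod.smul_snd,
        LinearMap.map_smul_of_tower, smul_add, mul_smul_comm])

theorem combination_apply (x y : P k r) : combination φp φm bp bm r x y
    = bp * φp (x : VV k).1 (y : VV k).1 + bm * φm (x : VV k).2 (y : VV k).2 := rfl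

variable {φp φm}

theorem isInvariantPairing_combination
    (hp : IsInvariant (k := k) (verma (k := k) (FracR k) r) φp)
    (hm : IsInvariant (k := k) (verma (k := k) (FracR k) (-r)) φm) :
    IsInvariantPairing (N := P k r) (repP k r) (combination φp φm bp bm r) := by
  intro u x y
  exact congrArg₂ (fun s t => bp * s + bm * t) (hp u (x : VV k).1 (y : VV k).1)
    (hm u (x : VV k).2 (y : VV k).2)

theorem combination_xP (hp : IsShapovalov k r r φp) :
    combination φp φm bp bm r (xP k r r) (xP k r r)
      = bp * algebraMap (R k) (FracR k) (qT k 0) ^ 2 := by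
  rw [combination_apply]
  change bp * φp (qT k 0 • Finsupp.single r 1) (qT k 0 • Finsupp.single r 1)
    + bm * φm (qT k 0 • 0) (qT k 0 • 0) = _
  rw [smul_zero, map_zero, mul_zero, add_zero, LinearMap.map_smul_of_tower,
    LinearMap.map_smul_of_tower, LinearMap.smul_apply, hp.2, Algebra.smul_def, Algebra.smul_def]
  ring

theorem combination_yP (hm : IsShapovalov k (-r) 0 φm) :
    combination φp φm bp bm r (yP k r 0) (yP k r 0)
      = bm * algebraMap (R k) (FracR k) (qT k 0) ^ 2 := by
  rw [combination_apply]
  change bp * φp (qT k 0 • 0) (qT k 0 • 0)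
    + bm * φm (qT k 0 • Finsupp.single 0 1) (qT k 0 • Finsupp.single 0 1) = _
  rw [smul_zero, map_zero, mul_zero, zero_add, LinearMap.map_smul_of_tower,
    LinearMap.map_smul_of_tower, LinearMap.smul_apply, hm.2, Algebra.smul_def, Algebra.smul_def]
  ring

/-- An `R`-valued invariant form on `P(m + r)` is a combination of the two Shapovalov forms in
exactly one way. -/
theorem existsUnique_isCombination [CharZero k] (hr : 0 < r)
    {ψ : LinearMap.BilinForm (R k) (P k r)} (hψ : IsInvariant (N := P k r) (repP k r) ψ)
    (hp : IsShapovalov k r r φp) (hm : IsShapovalov k (-r) 0 φm) :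
    ∃! b : FracR k × FracR k, IsCombination ψ φp φm b.1 b.2 := by
  set τ := algebraMap (R k) (FracR k) (qT k 0) with hτ
  have hτ0 : τ ^ 2 ≠ 0 := by
    refine pow_ne_zero 2 ?_
    rw [hτ, Ne, map_eq_zero_iff _ (FaithfulSMul.algebraMap_injective (R k) (FracR k))]
    exact qT_zero_ne_zero
  set A := algebraMap (R k) (FracR k) (ψ (xP k r r) (xP k r r))
  set C := algebraMap (R k) (FracR k) (ψ (yP k r 0) (yP k r 0))
  refine ⟨(A / τ ^ 2, C / τ ^ 2), fun x y => ?_, ?_⟩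
  · let B : P k r →ₗ[R k] P k r →ₗ[R k] FracR k :=
      ψ.compr₂ (Algebra.linearMap (R k) (FracR k)) - combination φp φm (A / τ ^ 2) (C / τ ^ 2) r
    have hBapp : ∀ x y, B x y = algebraMap (R k) (FracR k) (ψ x y)
        - combination φp φm (A / τ ^ 2) (C / τ ^ 2) r x y := fun x y => rfl
    have hB : IsInvariantPairing (N := P k r) (repP k r) B := fun u x y => by
      rw [hBapp, hBapp, hψ u x y, isInvariantPairing_combination _ _ hp.1 hm.1 u x y]
    have h0 : B = 0 := hB.eq_zero_on_P hr
      (by rw [hBapp, combination_xP _ _ hp, div_mul_cancel₀ _ hτ0, sub_self])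
      (by rw [hBapp, combination_yP _ _ hm, div_mul_cancel₀ _ hτ0, sub_self])
    have h1 := hBapp x y
    rw [h0] at h1
    exact sub_eq_zero.mp h1.symm
  · rintro ⟨bp, bm⟩ hb
    have h1 := (hb (xP k r r) (xP k r r)).trans (combination_xP bp bm hp)
    have h2 := (hb (yP k r 0) (yP k r 0)).trans (combination_yP bp bm hm)
    exact Prod.ext (by rw [eq_div_iff hτ0]; exact h1.symm) (by rw [eq_div_iff hτ0]; exact h2.symm)

end

/-! ### Values of the Shapovalov forms -/

section

variable {l : ℤ} {φ : LinearMap.BilinForm (FracR k) (ℕ →₀ FracR k)}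

/-- An invariant form on a Verma module is diagonal in the basis `w_j`. -/
theorem IsInvariant.apply_single (hφ : IsInvariant (k := k) (verma (k := k) (FracR k) l) φ)
    (x : ℕ →₀ FracR k) (j : ℕ) :
    φ x (Finsupp.single j 1) = x j * φ (Finsupp.single j 1) (Finsupp.single j 1) := by
  have hB : IsInvariantPairing (verma (k := k) (FracR k) l)
      (φ.restrictScalars₁₂ (R k) (R k)) := hφ
  have hw := isVermaFamily_verma (k := k) (FracR k) l
  induction x using Finsupp.induction_linear with
  | zero => simp
  | add a b ha hb => rw [map_add, LinearMap.add_apply, ha, hb, Finsupp.add_apply, add_mul]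
  | single i s =>
    rw [← mul_one s, ← smul_eq_mul, ← Finsupp.smul_single, map_smul, LinearMap.smul_apply]
    by_cases hij : i = j
    · subst hij
      simp
    · have h0 : φ (Finsupp.single i 1) (Finsupp.single j 1) = 0 :=
        hB.eq_zero_of_weight_ne hw hw (by omega)
      simp [h0, hij]

theorem IsInvariant.apply_single_add
    (hφ : IsInvariant (k := k) (verma (k := k) (FracR k) l) φ) (j n : ℕ) :
    φ (Finsupp.single (j + n) 1) (Finsupp.single (j + n) 1)
      = algebraMap (R k) (FracR k) (∏ m ∈ Finset.range n, shapRatio k l (j + m))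
        * φ (Finsupp.single j 1) (Finsupp.single j 1) := by
  have hB : IsInvariantPairing (verma (k := k) (FracR k) l)
      (φ.restrictScalars₁₂ (R k) (R k)) := hφ
  have hw := isVermaFamily_verma (k := k) (FracR k) l
  exact (hB.apply_add_add hw hw j j n).trans (Algebra.smul_def _ _)

theorem isUnit_prod_shapRatio {j n : ℕ} (h : l ≤ j ∨ j + n < l) :
    IsUnit (∏ m ∈ Finset.range n, shapRatio k l (j + m)) := by
  refine Finset.prod_induction _ IsUnit (fun _ _ => IsUnit.mul) isUnit_one fun m hm => ?_
  have := Finset.mem_range.mp hm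
  exact isUnit_shapRatio (by push_cast; omega)

/-- On `M(m + r)` the ratio with the factor `[T; 0]` is the one that leads from `w_{r-1}` to
`w_r`. -/
theorem IsShapovalov.ord_of_lt [CharZero k] {r : ℕ} (hφ : IsShapovalov k r r φ) {j : ℕ}
    (hj : j < r) : 1 + ord (φ (Finsupp.single j 1) (Finsupp.single j 1)) = 0 := by
  obtain ⟨n, hn⟩ := Nat.exists_eq_add_of_le hj
  have h := IsInvariant.apply_single_add hφ.1 j (n + 1)
  have e1 : j + (n + 1) = r := by omega
  have e2 : (r : ℤ) = ((j + n : ℕ) : ℤ) + 1 := by omega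
  have e3 : ord (algebraMap (R k) (FracR k) (shapRatio k r (j + n))) = 1 := by
    rw [e2]
    exact ord_shapRatio_self (j + n)
  rw [e1, hφ.2, Finset.prod_range_succ, map_mul] at h
  have h1 := congrArg ord h
  rw [ord_mul, ord_mul, e3, ord_algebraMap_of_isUnit (isUnit_prod_shapRatio (Or.inr (by omega))),
    zero_add] at h1
  rw [← h1, ← map_one (algebraMap (R k) (FracR k)), ord_algebraMap_of_isUnit isUnit_one]

theorem IsShapovalov.ord_add [CharZero k] {r : ℕ} (hφ : IsShapovalov k r r φ) (i : ℕ) :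
    ord (φ (Finsupp.single (r + i) 1) (Finsupp.single (r + i) 1)) = 0 := by
  rw [IsInvariant.apply_single_add hφ.1, hφ.2, mul_one, ord_algebraMap_of_isUnit]
  exact isUnit_prod_shapRatio (Or.inl le_rfl)

theorem IsShapovalov.ord_neg {r : ℕ} (hφ : IsShapovalov k (-r) 0 φ) (i : ℕ) :
    ord (φ (Finsupp.single i 1) (Finsupp.single i 1)) = 0 := by
  rw [← zero_add i, IsInvariant.apply_single_add hφ.1, hφ.2, mul_one, ord_algebraMap_of_isUnit]
  exact isUnit_prod_shapRatio (Or.inl (by omega))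

/-- The two Shapovalov forms agree modulo `T - 1` in equal weights. -/
theorem one_le_ord_shapovalov_sub [CharZero k] {r : ℕ}
    {φp φm : LinearMap.BilinForm (FracR k) (ℕ →₀ FracR k)} (hp : IsShapovalov k r r φp)
    (hm : IsShapovalov k (-r) 0 φm) (i : ℕ) :
    1 ≤ ord (φp (Finsupp.single (r + i) 1) (Finsupp.single (r + i) 1)
      - φm (Finsupp.single i 1) (Finsupp.single i 1)) := by
  have key : unif k ∣ (∏ m ∈ Finset.range i, shapRatio k r (r + m))
      - ∏ m ∈ Finset.range i, shapRatio k (-r) (0 + m) := by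
    induction i with
    | zero => simp
    | succ n ih =>
      have e : ∀ a b c d : R k, a * b - c * d = a * (b - d) + (a - c) * d :=
        fun a b c d => by ring
      rw [Finset.prod_range_succ, Finset.prod_range_succ, e, zero_add]
      exact dvd_add ((unif_dvd_shapRatio_sub r n).mul_left _) (ih.mul_right _)
  have h := IsInvariant.apply_single_add hm.1 0 i
  rw [zero_add, hm.2, mul_one] at h
  rwa [h, IsInvariant.apply_single_add hp.1, hp.2, mul_one, ← map_sub, ← unif_dvd_iff]

end

/-! ### Images of the filtration in the reduction -/

section

variable {B : Type*} [AddCommGroup B] [Module (R k) B]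

theorem smul_mem_unifMul {s : R k} (hs : unif k ∣ s) (x : B) : s • x ∈ unifMul k B := by
  obtain ⟨s, rfl⟩ := hs
  exact ⟨s • x, (mul_smul _ _ _).symm⟩

theorem redSub_eq_bot {A : Submodule (R k) B} (h : A ≤ unifMul k B) :
    redSub (k := k) A = ⊥ := by
  rw [redSub, eq_bot_iff, Submodule.map_le_iff_le_comap, Submodule.comap_bot, Submodule.ker_mkQ]
  exact h

theorem redSub_eq_top {A : Submodule (R k) B} (h : A = ⊤) : redSub (k := k) A = ⊤ := by
  rw [redSub, h, Submodule.map_top, Submodule.range_mkQ]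

/-- The image of `A` in the reduction is a reduced Verma module if, modulo `T - 1`, it is spanned by
a Verma family that stays independent in the reduction. -/
theorem IsVermaFamily.isoVerma_redSub {π : RU k →ₐ[R k] Module.End (R k) B} {l : ℤ} {w : ℕ → B}
    (hw : IsVermaFamily π l w) {A : Submodule (R k) B}
    (hind : ∀ y, Finsupp.linearCombination (R k) w y ∈ unifMul k B → ∀ j, unif k ∣ y j)
    (h1 : A ≤ LinearMap.range (Finsupp.linearCombination (R k) w) ⊔ unifMul k B)
    (h2 : ∀ j, w j ∈ A ⊔ unifMul k B) : IsoVerma π l (redSub (k := k) A) := by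
  set f := Finsupp.linearCombination (R k) w with hf
  set M := unifMul k (ℕ →₀ R k) with hM
  have hfM : M ≤ LinearMap.ker ((unifMul k B).mkQ ∘ₗ f) := by
    rintro _ ⟨y, rfl⟩
    rw [LinearMap.mem_ker, LinearMap.comp_apply, Submodule.mkQ_apply,
      Submodule.Quotient.mk_eq_zero]
    exact ⟨f y, (map_smul f (unif k) y).symm⟩
  have hker : LinearMap.ker ((unifMul k B).mkQ ∘ₗ f) ≤ M := by
    intro y hy
    rw [LinearMap.mem_ker, LinearMap.comp_apply, Submodule.mkQ_apply,
      Submodule.Quotient.mk_eq_zero] at hy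
    rw [← y.sum_single]
    refine Submodule.sum_mem _ fun j _ => ?_
    rw [← mul_one (y j), ← smul_eq_mul, ← Finsupp.smul_single]
    exact smul_mem_unifMul (hind y hy j) _
  have hrange : LinearMap.range (M.liftQ _ hfM) = redSub (k := k) A := by
    have e : ∀ C : Submodule (R k) B, (C ⊔ unifMul k B).map (unifMul k B).mkQ
        = C.map (unifMul k B).mkQ := fun C => by
      rw [Submodule.map_sup, Submodule.mkQ_map_self, sup_bot_eq]
    rw [Submodule.range_liftQ, LinearMap.range_comp, redSub]
    refine le_antisymm ?_ ?_
    · rw [← e A, hf, Finsupp.range_linearCombination]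
      exact Submodule.map_mono (Submodule.span_le.mpr (by rintro _ ⟨j, rfl⟩; exact h2 j))
    · rw [← e (LinearMap.range f)]
      exact Submodule.map_mono h1
  refine ⟨(LinearEquiv.ofInjective (M.liftQ _ hfM)
    (LinearMap.ker_eq_bot.mp (Submodule.ker_liftQ_eq_bot _ _ hfM hker))).trans
      (LinearEquiv.ofEq _ _ hrange), fun u x => ?_⟩
  obtain ⟨y, rfl⟩ := Submodule.Quotient.mk_surjective _ x
  exact congrArg (Submodule.Quotient.mk (p := unifMul k B)) (hw.linearCombination_apply u y)

end

section

variable {r : ℕ}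

theorem algebraMap_injective : Function.Injective (algebraMap (R k) (FracR k)) :=
  FaithfulSMul.algebraMap_injective (R k) (FracR k)

/-- The components in `M(m + r)` and `M(m - r)` of the element of `P(m + r)` with coefficients
`a_j` at the vectors `x_j` and `c_i` at the vectors `z_i`. -/
structure IsCoords (x : P k r) (a c : ℕ → R k) : Prop where
  fst_of_lt : ∀ j < r, (x : VV k).1 j = algebraMap (R k) (FracR k) (qT k 0 * a j)
  fst_add : ∀ i, (x : VV k).1 (r + i) = algebraMap (R k) (FracR k) (qT k 0 * a (r + i) + c i)
  snd : ∀ i, (x : VV k).2 i = algebraMap (R k) (FracR k) (c i)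

theorem isCoords_linearCombination (a c : ℕ →₀ R k) :
    IsCoords (Finsupp.linearCombination (R k) (xP k r) a
      + Finsupp.linearCombination (R k) (zP k r) c) a c where
  fst_of_lt j hj := by
    rw [Submodule.coe_add, Prod.fst_add, Finsupp.add_apply, linearCombination_xP_fst,
      linearCombination_zP_fst_of_lt c hj, add_zero]
  fst_add i := by
    rw [Submodule.coe_add, Prod.fst_add, Finsupp.add_apply, linearCombination_xP_fst,
      linearCombination_zP_fst_add, map_add (algebraMap (R k) (FracR k))]
  snd i := by
    rw [Submodule.coe_add, Prod.snd_add, Finsupp.add_apply, linearCombination_xP_snd,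
      linearCombination_zP_snd, Finsupp.zero_apply, zero_add]

/-- Every element of `P(m + r)` has coordinates, and lies in each submodule that contains the terms
of its expansion. -/
theorem exists_isCoords (x : P k r) : ∃ a c : ℕ → R k, IsCoords x a c ∧
    ∀ Q : Submodule (R k) (P k r), (∀ j, a j • xP k r j ∈ Q) → (∀ i, c i • zP k r i ∈ Q) →
      x ∈ Q := by
  obtain ⟨a, c, rfl⟩ := P_exists_coords x
  exact ⟨a, c, isCoords_linearCombination a c, fun Q ha hc =>
    Q.add_mem (Q.sum_mem fun j _ => ha j) (Q.sum_mem fun i _ => hc i)⟩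

theorem xP_independent [CharZero k] (y : ℕ →₀ R k)
    (hy : Finsupp.linearCombination (R k) (xP k r) y ∈ unifMul k (P k r)) (j : ℕ) :
    unif k ∣ y j := by
  obtain ⟨x, hx⟩ := hy
  obtain ⟨a, c, hx', -⟩ := exists_isCoords x
  have h1 : ∀ j, algebraMap (R k) (FracR k) (unif k) * (x : VV k).1 j
      = algebraMap (R k) (FracR k) (qT k 0 * y j) := fun j => by
    rw [← linearCombination_xP_fst (r := r), ← hx, ← Algebra.smul_def]
    rfl
  have h2 : ∀ i, algebraMap (R k) (FracR k) (unif k) * (x : VV k).2 i = 0 := fun i => by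
    rw [← Finsupp.zero_apply (α := ℕ) (a := i), ← linearCombination_xP_snd (r := r) y, ← hx,
      ← Algebra.smul_def]
    rfl
  refine ⟨a j, mul_left_cancel₀ (qT_zero_ne_zero (k := k)) (algebraMap_injective ?_)⟩
  rw [← h1]
  rcases lt_or_ge j r with hj | hj
  · rw [hx'.fst_of_lt j hj, ← map_mul]
    congr 1
    ring
  · obtain ⟨i, rfl⟩ := Nat.exists_eq_add_of_le hj
    have h3 := h2 i
    rw [hx'.snd, ← map_mul, map_eq_zero_iff _ algebraMap_injective, mul_eq_zero] at h3
    rw [hx'.fst_add, ← map_mul, h3.resolve_left unif_ne_zero]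
    congr 1
    ring

theorem linearCombination_yP (y : ℕ →₀ R k) :
    (∀ j, (Finsupp.linearCombination (R k) (yP k r) y : VV k).1 j = 0) ∧
    ∀ i, (Finsupp.linearCombination (R k) (yP k r) y : VV k).2 i
      = algebraMap (R k) (FracR k) (qT k 0 * y i) := by
  induction y using Finsupp.induction_linear with
  | zero => simp
  | add a b ha hb =>
    refine ⟨fun j => ?_, fun i => ?_⟩
    · rw [map_add, Submodule.coe_add, Prod.fst_add, Finsupp.add_apply, ha.1, hb.1, add_zero]
    · rw [map_add, Submodule.coe_add, Prod.snd_add, Finsupp.add_apply, ha.2, hb.2,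
        Finsupp.add_apply, mul_add, map_add]
  | single j s =>
    rw [Finsupp.linearCombination_single]
    refine ⟨fun i => ?_, fun i => ?_⟩
    · change (s • qT k 0 • (0 : ℕ →₀ FracR k)) i = 0
      simp
    · change (s • qT k 0 • Finsupp.single j (1 : FracR k)) i = _
      by_cases h : j = i
      · subst h
        simp [Algebra.smul_def, mul_comm]
      · simp [h]

theorem yP_independent [CharZero k] (y : ℕ →₀ R k)
    (hy : Finsupp.linearCombination (R k) (yP k r) y ∈ unifMul k (P k r)) (i : ℕ) :
    unif k ∣ y i := by
  obtain ⟨x, hx⟩ := hy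
  obtain ⟨a, c, hx', -⟩ := exists_isCoords x
  have h1 : algebraMap (R k) (FracR k) (unif k) * (x : VV k).1 (r + i) = 0 := by
    rw [← (linearCombination_yP (r := r) y).1 (r + i), ← hx, ← Algebra.smul_def]
    rfl
  have h2 : algebraMap (R k) (FracR k) (unif k) * (x : VV k).2 i
      = algebraMap (R k) (FracR k) (qT k 0 * y i) := by
    rw [← (linearCombination_yP (r := r) y).2 i, ← hx, ← Algebra.smul_def]
    rfl
  rw [hx'.fst_add, ← map_mul, map_eq_zero_iff _ algebraMap_injective, mul_eq_zero] at h1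
  rw [hx'.snd, ← map_mul] at h2
  have h3 := h1.resolve_left unif_ne_zero
  have h4 := algebraMap_injective h2
  refine ⟨-a (r + i), mul_left_cancel₀ (qT_zero_ne_zero (k := k)) ?_⟩
  linear_combination -h4 + unif k * h3

end

/-! ### The filtration of an invariant form -/

section

variable {r : ℕ} {ψ : LinearMap.BilinForm (R k) (P k r)}
  {φp φm : LinearMap.BilinForm (FracR k) (ℕ →₀ FracR k)} {bp bm : FracR k}

theorem IsCombination.apply_xP (hψ : IsCombination ψ φp φm bp bm) (hp : IsShapovalov k r r φp)
    (x : P k r) (j : ℕ) : algebraMap (R k) (FracR k) (ψ x (xP k r j))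
      = bp * (algebraMap (R k) (FracR k) (qT k 0)
        * ((x : VV k).1 j * φp (Finsupp.single j 1) (Finsupp.single j 1))) := by
  rw [hψ]
  change bp * φp (x : VV k).1 (qT k 0 • Finsupp.single j 1) + bm * φm (x : VV k).2 (qT k 0 • 0) = _
  rw [smul_zero, map_zero, mul_zero, add_zero, LinearMap.map_smul_of_tower,
    IsInvariant.apply_single hp.1, Algebra.smul_def]

theorem IsCombination.apply_zP (hψ : IsCombination ψ φp φm bp bm) (hp : IsShapovalov k r r φp)
    (hm : IsShapovalov k (-r) 0 φm) (x : P k r) (i : ℕ) :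
    algebraMap (R k) (FracR k) (ψ x (zP k r i))
      = bp * ((x : VV k).1 (r + i) * φp (Finsupp.single (r + i) 1) (Finsupp.single (r + i) 1))
        + bm * ((x : VV k).2 i * φm (Finsupp.single i 1) (Finsupp.single i 1)) := by
  rw [hψ]
  change bp * φp (x : VV k).1 (Finsupp.single (r + i) 1 + 0)
    + bm * φm (x : VV k).2 (0 + Finsupp.single i 1) = _
  rw [add_zero, zero_add, IsInvariant.apply_single hp.1, IsInvariant.apply_single hm.1]

/-- The filtration in terms of the components in `M(m + r)` and `M(m - r)`: its conditions are
orthogonality conditions in each weight space. -/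
theorem mem_formFiltration_iff [CharZero k] (hψ : IsCombination ψ φp φm bp bm)
    (hp : IsShapovalov k r r φp) (hm : IsShapovalov k (-r) 0 φm) (n : ℕ) (x : P k r) :
    x ∈ formFiltration (B := P k r) ψ n ↔
      (∀ j < r, ((n : ℤ) : WithTop ℤ) ≤ ord bp + ord ((x : VV k).1 j)) ∧
      (∀ i, ((n : ℤ) : WithTop ℤ) ≤ ord bp + 1 + ord ((x : VV k).1 (r + i))) ∧
      ∀ i, ((n : ℤ) : WithTop ℤ) ≤
        ord (bp * ((x : VV k).1 (r + i) * φp (Finsupp.single (r + i) 1) (Finsupp.single (r + i) 1))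
          + bm * ((x : VV k).2 i * φm (Finsupp.single i 1) (Finsupp.single i 1))) := by
  have hX : ∀ j, unif k ^ n ∣ ψ x (xP k r j) ↔ ((n : ℤ) : WithTop ℤ) ≤ ord bp +
      (1 + ord (φp (Finsupp.single j 1) (Finsupp.single j 1))) + ord ((x : VV k).1 j) := by
    intro j
    rw [unif_pow_dvd_iff, hψ.apply_xP hp, ord_mul, ord_mul, ord_mul, ord_qT_zero,
      add_comm (ord ((x : VV k).1 j)), ← add_assoc 1, ← add_assoc]
  have hZ : ∀ i, unif k ^ n ∣ ψ x (zP k r i) ↔ _ := fun i => by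
    rw [unif_pow_dvd_iff, hψ.apply_zP hp hm]
  have h : x ∈ formFiltration (B := P k r) ψ n ↔
      (∀ j, unif k ^ n ∣ ψ x (xP k r j)) ∧ ∀ i, unif k ^ n ∣ ψ x (zP k r i) := by
    refine ⟨fun h => ⟨fun j => h _, fun i => h _⟩, fun h y => ?_⟩
    let Q : Submodule (R k) (P k r) := Submodule.comap (ψ x) (Ideal.span {unif k ^ n})
    have hQ : ∀ y, y ∈ Q ↔ unif k ^ n ∣ ψ x y := fun y => Ideal.mem_span_singleton
    have := P_submodule_eq_top (Q := Q) (fun j => (hQ _).mpr (h.1 j)) (fun i => (hQ _).mpr (h.2 i))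
    exact (hQ y).mp (this ▸ Submodule.mem_top)
  rw [h]
  simp only [hX, hZ]
  constructor
  · rintro ⟨h1, h2⟩
    refine ⟨fun j hj => ?_, fun i => ?_, h2⟩
    · have := h1 j
      rwa [hp.ord_of_lt hj, add_zero] at this
    · have := h1 (r + i)
      rwa [hp.ord_add, add_zero] at this
  · rintro ⟨h1, h2, h3⟩
    refine ⟨fun j => ?_, h3⟩
    rcases lt_or_ge j r with hj | hj
    · rw [hp.ord_of_lt hj, add_zero]
      exact h1 j hj
    · obtain ⟨i, rfl⟩ := Nat.exists_eq_add_of_le hj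
      rw [hp.ord_add, add_zero]
      exact h2 i

/-- The value of `b₊ φ₊ + b₋ φ₋` at `(z_i, z_i)` is `b₊ + b₋` up to a unit and up to a term of
order greater than `ord b₊`. -/
theorem exists_gram_eq [CharZero k] (hp : IsShapovalov k r r φp) (hm : IsShapovalov k (-r) 0 φm)
    (bp bm : FracR k) (i : ℕ) : ∃ s t : FracR k,
      bp * φp (Finsupp.single (r + i) 1) (Finsupp.single (r + i) 1)
        + bm * φm (Finsupp.single i 1) (Finsupp.single i 1) = s + t ∧
      ord s = ord (bp + bm) ∧ ord bp + 1 ≤ ord t := by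
  refine ⟨(bp + bm) * φm (Finsupp.single i 1) (Finsupp.single i 1),
    bp * (φp (Finsupp.single (r + i) 1) (Finsupp.single (r + i) 1)
      - φm (Finsupp.single i 1) (Finsupp.single i 1)), by ring, ?_, ?_⟩
  · rw [ord_mul, hm.ord_neg, add_zero]
  · rw [ord_mul]
    exact add_le_add le_rfl (one_le_ord_shapovalov_sub hp hm i)

theorem IsCombination.ord_nonneg [CharZero k] (hψ : IsCombination ψ φp φm bp bm)
    (hp : IsShapovalov k r r φp) (hm : IsShapovalov k (-r) 0 φm) : 0 ≤ ord (bp + bm) := by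
  have h := hψ.apply_zP hp hm (zP k r 0) 0
  have h1 : (zP k r 0 : VV k).1 (r + 0) = 1 := by
    change (Finsupp.single (r + 0) (1 : FracR k) + 0) (r + 0) = 1
    simp
  have h2 : (zP k r 0 : VV k).2 0 = 1 := by
    change (0 + Finsupp.single 0 (1 : FracR k)) 0 = 1
    simp
  rw [h1, h2, one_mul, one_mul, add_zero, hp.2, hm.2, mul_one, mul_one] at h
  rw [← h]
  exact ord_algebraMap_nonneg _

theorem IsCombination.ord_left_add_one_nonneg [CharZero k] (hψ : IsCombination ψ φp φm bp bm)
    (hp : IsShapovalov k r r φp) : 0 ≤ ord bp + 1 := by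
  have h := hψ.apply_xP hp (zP k r 0) r
  have h1 : (zP k r 0 : VV k).1 r = 1 := by
    change (Finsupp.single (r + 0) (1 : FracR k) + 0) r = 1
    simp
  rw [h1, one_mul, hp.2, mul_one] at h
  rw [← ord_qT_zero (k := k), ← ord_mul, ← h]
  exact ord_algebraMap_nonneg _

theorem coe_le_of_le_coe_add {b m n : ℤ} {α : WithTop ℤ} (h : (n : WithTop ℤ) ≤ b + α)
    (hm : b + m ≤ n) : (m : WithTop ℤ) ≤ α := by
  induction α using WithTop.recTopCoe with
  | top => exact le_top
  | coe a =>
    norm_cast at h ⊢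
    omega

theorem exists_coe_of_lt {α β : WithTop ℤ} (h : α < β) : ∃ a : ℤ, α = a :=
  (WithTop.ne_top_iff_exists.mp (ne_top_of_lt h)).imp fun _ => Eq.symm

/-- The value at `(x, z_i)` in terms of the coordinates `a` and `c` of `x`. -/
theorem gram_expand (bp bm p m t a c : FracR k) :
    bp * ((t * a + c) * p) + bm * (c * m) = bp * (t * (a * p)) + (bp * p + bm * m) * c := by
  ring

theorem ord_gram_xP [CharZero k] (hp : IsShapovalov k r r φp) (i : ℕ) (b a : FracR k) :
    ord (b * (algebraMap (R k) (FracR k) (qT k 0)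
      * (a * φp (Finsupp.single (r + i) 1) (Finsupp.single (r + i) 1)))) = ord b + 1 + ord a := by
  rw [ord_mul, ord_mul, ord_mul, ord_qT_zero, hp.ord_add, add_zero, add_assoc]

/-- If `b₊ + b₋` has larger order than `b₊` and `b₋`, then the form is, in each weight space,
`(T - 1) ^ (ord b₊ + 1)` times a nondegenerate form over `R`. -/
theorem hasType_of_ord_lt [CharZero k] (hψ : IsCombination ψ φp φm bp bm)
    (hp : IsShapovalov k r r φp) (hm : IsShapovalov k (-r) 0 φm) (h1 : ord bp = ord bm)
    (h2 : ord bm < ord (bp + bm)) :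
    HasType (repP k r) r (formFiltration (B := P k r) ψ)
      (ord bp + 1) (ord bp + 1) (ord bp + 1) := by
  obtain ⟨b, hb⟩ := exists_coe_of_lt (h1.trans_lt h2)
  have h0 := hψ.ord_left_add_one_nonneg hp
  have hle : ord bp + 1 ≤ ord (bp + bm) := by
    rw [← h1, hb] at h2
    rw [hb]
    generalize ord (bp + bm) = s at h2
    induction s using WithTop.recTopCoe with
    | top => exact le_top
    | coe s => exact_mod_cast h2
  have hd : ∀ i, ord bp + 1 ≤ ord (bp * φp (Finsupp.single (r + i) 1) (Finsupp.single (r + i) 1)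
        + bm * φm (Finsupp.single i 1) (Finsupp.single i 1)) := fun i => by
    obtain ⟨s, t, hst, hs, ht⟩ := exists_gram_eq hp hm bp bm i
    rw [hst]
    exact le_ord_add (hle.trans_eq hs.symm) ht
  rw [hb] at hd h0 ⊢
  refine ⟨h0, le_rfl, le_rfl, fun n => ⟨fun hn => redSub_eq_top ?_,
    fun h => absurd h.2 (not_le.mpr h.1), fun h => absurd h.2 (not_le.mpr h.1),
    fun hn => redSub_eq_bot ?_⟩⟩
  · refine eq_top_iff.mpr fun x _ => (mem_formFiltration_iff hψ hp hm n x).mpr ?_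
    obtain ⟨a, c, hx, -⟩ := exists_isCoords x
    refine ⟨fun j hj => hn.trans ?_, fun i => hn.trans ?_, fun i => hn.trans ?_⟩
    · rw [hx.fst_of_lt j hj, map_mul, ord_mul, ord_qT_zero, ← add_assoc, hb]
      exact le_add_of_nonneg_right (ord_algebraMap_nonneg _)
    · rw [hx.fst_add, hb]
      exact le_add_of_nonneg_right (ord_algebraMap_nonneg _)
    · rw [hx.fst_add, hx.snd, map_add, map_mul, gram_expand]
      refine le_ord_add ?_ ?_
      · rw [ord_gram_xP hp, hb]
        exact le_add_of_nonneg_right (ord_algebraMap_nonneg _)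
      · rw [ord_mul]
        exact (hd i).trans (le_add_of_nonneg_right (ord_algebraMap_nonneg _))
  · intro x hx
    have hbn : b + 1 + 1 ≤ n := by
      norm_cast at hn
    obtain ⟨hx1, hx2, hx3⟩ := (mem_formFiltration_iff hψ hp hm n x).mp hx
    obtain ⟨a, c, hac, hQ⟩ := exists_isCoords x
    have hS : ∀ i, 1 ≤ ord (algebraMap (R k) (FracR k) (qT k 0 * a (r + i) + c i)) := fun i => by
      have h := hx2 i
      rw [hac.fst_add, hb] at h
      exact coe_le_of_le_coe_add (b := b + 1) h hbn
    have hc : ∀ i, 1 ≤ ord (algebraMap (R k) (FracR k) (c i)) := fun i => by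
      rw [← add_sub_cancel_left (qT k 0 * a (r + i)) (c i), map_sub]
      refine le_ord_sub (hS i) ?_
      rw [map_mul, ord_mul, ord_qT_zero]
      exact le_add_of_nonneg_right (ord_algebraMap_nonneg _)
    refine hQ _ (fun j => smul_mem_unifMul (unif_dvd_iff.mpr ?_) _)
      (fun i => smul_mem_unifMul (unif_dvd_iff.mpr (hc i)) _)
    rcases lt_or_ge j r with hj | hj
    · have h := hx1 j hj
      rw [hac.fst_of_lt j hj, map_mul, ord_mul, ord_qT_zero, hb, ← add_assoc] at h
      exact coe_le_of_le_coe_add (b := b + 1) h hbn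
    · obtain ⟨i, rfl⟩ := Nat.exists_eq_add_of_le hj
      have h := hx3 i
      rw [hac.fst_add, hac.snd, map_add, map_mul, gram_expand] at h
      have h3 : ((b + 1 + 1 : ℤ) : WithTop ℤ) ≤ (b + 1 : ℤ)
          + ord (algebraMap (R k) (FracR k) (a (r + i))) := by
        have e := ord_gram_xP hp i bp (algebraMap (R k) (FracR k) (a (r + i)))
        rw [hb] at e
        refine le_of_le_of_eq ?_ e
        refine le_of_le_of_eq (le_ord_sub (le_trans (by exact_mod_cast hbn) h) ?_)
          (congrArg ord (add_sub_cancel_right _ _))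
        rw [ord_mul]
        exact add_le_add (hd i) (hc i)
      exact coe_le_of_le_coe_add h3 le_rfl

/-- If `u + w` lies in a submodule, then so does `w` when `u` does. -/
theorem mem_of_add_mem_of_mem {B : Type*} [AddCommGroup B] [Module (R k) B]
    {Q : Submodule (R k) B} {u w : B} (h : u + w ∈ Q) (hu : u ∈ Q) : w ∈ Q :=
  (Q.add_mem_iff_right hu).mp h

theorem smul_add_add_neg_smul {B : Type*} [AddCommGroup B] [Module (R k) B] (q : R k) (z x : B) :
    q • z + (x + -q • z) = x := by
  rw [add_left_comm, ← add_smul, add_neg_cancel, zero_smul, add_zero]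

theorem yP_add_xP_mem [CharZero k] (i : ℕ) : yP k r i + xP k r (r + i) ∈ unifMul k (P k r) := by
  rw [← smul_zP]
  obtain ⟨u, -, hu⟩ := qT_zero_eq (k := k)
  exact smul_mem_unifMul ⟨u, hu⟩ _

/-- If the value at `(z_i, z_i)` has order `e ≤ ord b₊`, then `x_{r+i}` can be corrected by a
multiple of `(T - 1) z_i` to a vector orthogonal to `z_i`, whose value under the form has order
`γ = ord b₊ + ord b₋ + 2 - e`. -/
theorem xP_add_mem [CharZero k] (hψ : IsCombination ψ φp φm bp bm)
    (hp : IsShapovalov k r r φp) (hm : IsShapovalov k (-r) 0 φm) {e : ℤ} {γ : WithTop ℤ} {n i : ℕ}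
    (hd : ord (bp * φp (Finsupp.single (r + i) 1) (Finsupp.single (r + i) 1)
        + bm * φm (Finsupp.single i 1) (Finsupp.single i 1)) = e)
    (heb : e ≤ ord bp) (hγ : γ + e = ord bp + ord bm + 2) (hn : ((n : ℤ) : WithTop ℤ) ≤ γ) :
    xP k r (r + i) ∈ formFiltration (B := P k r) ψ n ⊔ unifMul k (P k r) := by
  set p := φp (Finsupp.single (r + i) 1) (Finsupp.single (r + i) 1) with hpdef
  set m := φm (Finsupp.single i 1) (Finsupp.single i 1) with hmdef
  set d := bp * p + bm * m with hddef
  set τ := algebraMap (R k) (FracR k) (qT k 0) with hτ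
  have hp0 : ord p = 0 := hp.ord_add i
  have hm0 : ord m = 0 := hm.ord_neg i
  have hτ1 : ord τ = 1 := ord_qT_zero
  have hd0 : d ≠ 0 := by
    intro h
    rw [h, ord_zero] at hd
    exact WithTop.top_ne_coe hd
  obtain ⟨q, hq⟩ : ∃ q, d * q = τ * (bp * p) := ⟨_, mul_div_cancel₀ _ hd0⟩
  have hq1 : 1 ≤ ord q := by
    have h := congrArg ord hq
    rw [ord_mul, ord_mul, ord_mul, hd, hτ1, hp0, add_zero] at h
    refine coe_le_of_le_coe_add (n := 1 + e) (b := e) (h ▸ ?_) (by omega)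
    exact add_le_add le_rfl heb
  obtain ⟨q, rfl⟩ := exists_algebraMap_eq (zero_le_one.trans hq1)
  set x' : P k r := Finsupp.linearCombination (R k) (xP k r) (Finsupp.single (r + i) 1)
    + Finsupp.linearCombination (R k) (zP k r) (Finsupp.single i (-q)) with hx'
  have hc := isCoords_linearCombination (r := r) (k := k) (Finsupp.single (r + i) 1)
    (Finsupp.single i (-q))
  have hmem : x' ∈ formFiltration (B := P k r) ψ n := by
    refine (mem_formFiltration_iff hψ hp hm n x').mpr ⟨fun j hj => ?_, fun i' => ?_, fun i' => ?_⟩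
    · rw [hc.fst_of_lt j hj, Finsupp.single_eq_of_ne (by omega), mul_zero, map_zero, ord_zero,
        WithTop.add_top]
      exact le_top
    · rw [hc.fst_add]
      by_cases hi : i' = i
      · subst hi
        rw [Finsupp.single_eq_same, Finsupp.single_eq_same, mul_one, ← sub_eq_add_neg, map_sub]
        have e1 : d * (τ - algebraMap (R k) (FracR k) q) = τ * (bm * m) := by
          rw [mul_sub, hq, hddef]
          ring
        have h := congrArg ord e1
        rw [ord_mul, ord_mul, ord_mul, hd, hτ1, hm0, add_zero] at h
        have h3 : γ + e ≤ ord bp + 1 + ord (τ - algebraMap (R k) (FracR k) q) + e := by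
          rw [hγ, add_assoc _ _ (e : WithTop ℤ), add_comm _ (e : WithTop ℤ), h]
          exact le_of_eq (by rw [← one_add_one_eq_two]; ac_rfl)
        exact hn.trans ((WithTop.add_le_add_iff_right WithTop.coe_ne_top).mp h3)
      · rw [Finsupp.single_eq_of_ne (by omega), Finsupp.single_eq_of_ne hi, mul_zero, add_zero,
          map_zero, ord_zero, WithTop.add_top]
        exact le_top
    · rw [hc.fst_add, hc.snd]
      refine le_of_le_of_eq le_top (Eq.symm (ord_eq_top.mpr ?_))
      by_cases hi : i' = i
      · subst hi
        rw [Finsupp.single_eq_same, Finsupp.single_eq_same, mul_one, map_add, map_neg]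
        linear_combination -hq
      · rw [Finsupp.single_eq_of_ne (by omega), Finsupp.single_eq_of_ne hi]
        simp
  have hx : q • zP k r i + x' = xP k r (r + i) := by
    rw [hx', Finsupp.linearCombination_single, Finsupp.linearCombination_single, one_smul]
    exact smul_add_add_neg_smul (B := P k r) q _ _
  rw [← hx]
  exact Submodule.add_mem _
    (Submodule.mem_sup_right (smul_mem_unifMul (unif_dvd_iff.mpr hq1) _))
    (Submodule.mem_sup_left hmem)

/-- In degrees above the order of the value at `(z_i, z_i)`, the coefficient at `z_i` is divisible
by `T - 1`. -/
theorem unif_dvd_coord_zP [CharZero k] (hψ : IsCombination ψ φp φm bp bm)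
    (hp : IsShapovalov k r r φp) (hm : IsShapovalov k (-r) 0 φm) {e : ℤ} {n i : ℕ}
    (hd : ord (bp * φp (Finsupp.single (r + i) 1) (Finsupp.single (r + i) 1)
        + bm * φm (Finsupp.single i 1) (Finsupp.single i 1)) = e)
    (heb : e ≤ ord bp) (hn : (e : WithTop ℤ) < (n : ℤ)) {x : P k r}
    (hx : x ∈ formFiltration (B := P k r) ψ n) {a c : ℕ → R k} (hac : IsCoords x a c) :
    unif k ∣ c i := by
  have h := ((mem_formFiltration_iff hψ hp hm n x).mp hx).2.2 i
  rw [hac.fst_add, hac.snd, map_add, map_mul, gram_expand] at h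
  have hn' : ((e + 1 : ℤ) : WithTop ℤ) ≤ (n : ℤ) := by
    norm_cast at hn ⊢
  refine unif_dvd_iff.mpr (coe_le_of_le_coe_add (b := e) (n := e + 1) ?_ le_rfl)
  rw [← hd, ← ord_mul]
  refine le_of_le_of_eq (le_ord_sub (hn'.trans h) ?_) (congrArg ord (add_sub_cancel_left _ _))
  rw [ord_gram_xP hp]
  exact le_trans (add_le_add heb le_rfl) (le_add_of_nonneg_right (ord_algebraMap_nonneg _))

/-- In degrees above `ord b₊ + 1`, the coefficients at the vectors `x_j` above the weight of `w_+`
are divisible by `T - 1`. -/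
theorem unif_dvd_coord_xP [CharZero k] (hψ : IsCombination ψ φp φm bp bm)
    (hp : IsShapovalov k r r φp) (hm : IsShapovalov k (-r) 0 φm) {n j : ℕ} (hj : j < r)
    (hn : ord bp + 1 < (n : ℤ)) {x : P k r} (hx : x ∈ formFiltration (B := P k r) ψ n)
    {a c : ℕ → R k} (hac : IsCoords x a c) : unif k ∣ a j := by
  have h := ((mem_formFiltration_iff hψ hp hm n x).mp hx).1 j hj
  obtain ⟨b, hb⟩ := exists_coe_of_lt ((le_add_of_nonneg_right zero_le_one).trans_lt hn)
  rw [hac.fst_of_lt j hj, map_mul, ord_mul, ord_qT_zero, hb, ← add_assoc] at h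
  rw [hb] at hn
  exact unif_dvd_iff.mpr (coe_le_of_le_coe_add (b := b + 1) h (by norm_cast at hn))

/-- If `δ = ord (b₊ + b₋)` is at most `ord b₊` and `ord b₋`, then in each weight space from that of
`w_+` downwards the form is diagonalizable over `R` with entries of orders `δ` and
`γ = ord b₊ + ord b₋ + 2 - δ`. The order `γ` is given by an equation without subtraction, which
leaves it free when `δ = ⊤`; the last hypothesis expresses that `δ` is at most `ord b₋`. -/
theorem hasType_of_ord_le [CharZero k] (hψ : IsCombination ψ φp φm bp bm)
    (hp : IsShapovalov k r r φp) (hm : IsShapovalov k (-r) 0 φm) {γ : WithTop ℤ}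
    (hp1 : ord (bp + bm) ≤ ord bp) (hγ : γ + ord (bp + bm) = ord bp + ord bm + 2)
    (hpγ : ord bp + 2 ≤ γ) :
    HasType (repP k r) r (formFiltration (B := P k r) ψ) (ord (bp + bm)) (ord bp + 1) γ := by
  have hβ1 : ord bp ≤ ord bp + 1 := le_add_of_nonneg_right zero_le_one
  have hd : ∀ i, ord (bp * φp (Finsupp.single (r + i) 1) (Finsupp.single (r + i) 1)
        + bm * φm (Finsupp.single i 1) (Finsupp.single i 1)) = ord (bp + bm) := fun i => by
    obtain ⟨s, t, hst, hs, ht⟩ := exists_gram_eq hp hm bp bm i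
    rw [hst]
    by_cases hfin : ord (bp + bm) = ⊤
    · rw [hfin]
      refine top_le_iff.mp (le_ord_add (hs.trans hfin).ge ?_)
      rw [hfin, top_le_iff] at hp1
      rwa [hp1, WithTop.top_add] at ht
    · refine (ord_add_eq_left (lt_of_lt_of_le ?_ ht)).trans hs
      rw [hs]
      obtain ⟨e, he⟩ := WithTop.ne_top_iff_exists.mp hfin
      rw [← he] at hp1 ⊢
      exact lt_of_lt_of_le (by exact_mod_cast Int.lt_succ e) (add_le_add hp1 le_rfl)
  refine ⟨hψ.ord_nonneg hp hm, hp1.trans hβ1, le_trans (add_le_add le_rfl one_le_two) hpγ,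
    fun n => ⟨fun hn => redSub_eq_top ?_, ?_, ?_, fun hn => redSub_eq_bot ?_⟩⟩
  · refine eq_top_iff.mpr fun x _ => (mem_formFiltration_iff hψ hp hm n x).mpr ?_
    obtain ⟨a, c, hx, -⟩ := exists_isCoords x
    refine ⟨fun j hj => hn.trans (hp1.trans ?_), fun i => hn.trans (hp1.trans (hβ1.trans ?_)),
      fun i => hn.trans ?_⟩
    · rw [hx.fst_of_lt j hj]
      exact le_add_of_nonneg_right (ord_algebraMap_nonneg _)
    · rw [hx.fst_add]
      exact le_add_of_nonneg_right (ord_algebraMap_nonneg _)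
    · rw [hx.fst_add, hx.snd, map_add, map_mul, gram_expand]
      refine le_ord_add (hp1.trans ?_) ?_
      · rw [ord_gram_xP hp]
        exact hβ1.trans (le_add_of_nonneg_right (ord_algebraMap_nonneg _))
      · rw [ord_mul, hd]
        exact le_add_of_nonneg_right (ord_algebraMap_nonneg _)
  · rintro ⟨hn1, hn2⟩
    obtain ⟨e, he⟩ := exists_coe_of_lt hn1
    rw [he] at hn1 hp1 hγ hd
    refine (isVermaFamily_xP k r).isoVerma_redSub (B := P k r) xP_independent (fun x hx => ?_)
      fun j => ?_
    · obtain ⟨a, c, hac, hQ⟩ := exists_isCoords x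
      exact hQ _ (fun j => Submodule.mem_sup_left ⟨Finsupp.single j (a j), by simp⟩) fun i =>
        Submodule.mem_sup_right (smul_mem_unifMul
          (unif_dvd_coord_zP hψ hp hm (hd i) hp1 hn1 hx hac) _)
    · rcases lt_or_ge j r with hj | hj
      · refine Submodule.mem_sup_left ((mem_formFiltration_iff hψ hp hm n _).mpr
          ⟨fun i _ => hn2.trans ?_, fun i => ?_, fun i => ?_⟩)
        · change ord bp + 1 ≤ ord bp + ord ((qT k 0 • Finsupp.single j (1 : FracR k)) i)
          rw [Finsupp.smul_apply, Algebra.smul_def, ord_mul, ord_qT_zero]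
          refine add_le_add le_rfl (le_add_of_nonneg_right ?_)
          rw [Finsupp.single_apply]
          split_ifs
          · rw [← map_one (algebraMap (R k) (FracR k))]
            exact ord_algebraMap_nonneg _
          · rw [ord_zero]
            exact le_top
        all_goals
          have h0 : (xP k r j : VV k).1 (r + i) = 0 := by
            change (qT k 0 • Finsupp.single j (1 : FracR k)) (r + i) = 0
            rw [Finsupp.smul_apply, Finsupp.single_eq_of_ne (by omega), smul_zero]
        · rw [h0, ord_zero, WithTop.add_top]
          exact le_top
        · have h1 : (xP k r j : VV k).2 i = 0 := by
            change (qT k 0 • (0 : ℕ →₀ FracR k)) i = 0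
            rw [smul_zero, Finsupp.zero_apply]
          rw [h0, h1, zero_mul, zero_mul, mul_zero, mul_zero, add_zero, ord_zero]
          exact le_top
      · obtain ⟨i, rfl⟩ := Nat.exists_eq_add_of_le hj
        exact xP_add_mem hψ hp hm (hd i) hp1 hγ
          (hn2.trans ((add_le_add le_rfl one_le_two).trans hpγ))
  · rintro ⟨hn1, hn2⟩
    have hδn := (hp1.trans hβ1).trans_lt hn1
    obtain ⟨e, he⟩ := exists_coe_of_lt hδn
    rw [he] at hδn hp1 hγ hd
    refine (isVermaFamily_yP k r).isoVerma_redSub (B := P k r) yP_independent (fun x hx => ?_)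
      fun i => ?_
    · obtain ⟨a, c, hac, hQ⟩ := exists_isCoords x
      refine hQ _ (fun j => ?_) fun i =>
        Submodule.mem_sup_right (smul_mem_unifMul
          (unif_dvd_coord_zP hψ hp hm (hd i) hp1 hδn hx hac) _)
      rcases lt_or_ge j r with hj | hj
      · exact Submodule.mem_sup_right (smul_mem_unifMul
          (unif_dvd_coord_xP hψ hp hm hj hn1 hx hac) _)
      · obtain ⟨i, rfl⟩ := Nat.exists_eq_add_of_le hj
        exact Submodule.smul_mem _ _ (mem_of_add_mem_of_mem (B := P k r)
          (Submodule.mem_sup_right (yP_add_xP_mem i))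
          (Submodule.mem_sup_left ⟨Finsupp.single i 1, by simp⟩))
    · refine mem_of_add_mem_of_mem (B := P k r) (u := xP k r (r + i)) (Submodule.mem_sup_right ?_)
        (xP_add_mem hψ hp hm (hd i) hp1 hγ hn2)
      rw [add_comm]
      exact yP_add_xP_mem i
  · have hβn : ord bp + 1 < (n : ℤ) :=
      ((add_le_add le_rfl one_le_two).trans hpγ).trans_lt hn
    have hδn := (hp1.trans hβ1).trans_lt hβn
    obtain ⟨e, he⟩ := exists_coe_of_lt hδn
    obtain ⟨c', rfl⟩ := exists_coe_of_lt hn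
    rw [he] at hδn hp1 hγ hd
    intro x hx
    obtain ⟨a, c, hac, hQ⟩ := exists_isCoords x
    refine hQ _ (fun j => smul_mem_unifMul ?_ _)
      fun i => smul_mem_unifMul (unif_dvd_coord_zP hψ hp hm (hd i) hp1 hδn hx hac) _
    rcases lt_or_ge j r with hj | hj
    · exact unif_dvd_coord_xP hψ hp hm hj hβn hx hac
    obtain ⟨i, rfl⟩ := Nat.exists_eq_add_of_le hj
    obtain ⟨hx1, hx2, hx3⟩ := (mem_formFiltration_iff hψ hp hm n x).mp hx
    have h2 := hx2 i
    have h3 := hx3 i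
    -- eliminating `c_i` between the conditions at `x_{r+i}` and `z_i` isolates `a_{r+i}`
    have key : ∀ p m t a c : FracR k, bm * (m * (t * a)) = (bp * p + bm * m) * (t * a + c)
        - (bp * ((t * a + c) * p) + bm * (c * m)) := fun p m t a c => by ring
    rw [hac.fst_add, map_add, map_mul] at h2
    rw [hac.fst_add, hac.snd, map_add, map_mul] at h3
    have h4 := congrArg ord (key (φp (Finsupp.single (r + i) 1) (Finsupp.single (r + i) 1))
      (φm (Finsupp.single i 1) (Finsupp.single i 1)) (algebraMap (R k) (FracR k) (qT k 0))
      (algebraMap (R k) (FracR k) (a (r + i))) (algebraMap (R k) (FracR k) (c i)))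
    rw [ord_mul, ord_mul, ord_mul, hm.ord_neg, ord_qT_zero, zero_add] at h4
    rw [unif_dvd_iff]
    have h5 := h4.ge.trans' (le_ord_sub (min_le_left _ _) ((min_le_right _ _).trans h3))
    rw [ord_mul, hd, min_le_iff] at h5
    generalize ord (algebraMap (R k) (FracR k) (a (r + i))) = α at h5 ⊢
    generalize ord (_ + algebraMap (R k) (FracR k) (c i)) = σ at h2 h5
    generalize ord bp = β at *
    generalize ord bm = ε at *
    induction α using WithTop.recTopCoe with
    | top => exact le_top
    | coe α =>
    induction β using WithTop.recTopCoe with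
    | top => simp at hβn
    | coe β =>
    induction ε using WithTop.recTopCoe with
    | top =>
      rw [WithTop.add_top, WithTop.top_add] at hγ
      exact absurd hγ WithTop.coe_ne_top
    | coe ε =>
    have hγ' : c' + e = β + ε + 2 := WithTop.coe_injective hγ
    induction σ using WithTop.recTopCoe with
    | top =>
      rw [WithTop.add_top, top_le_iff, or_iff_right (by exact WithTop.coe_ne_top)] at h5
      norm_cast at *
      omega
    | coe σ =>
      norm_cast at *
      omega

end

end QuantumSl2
end

open QuantumSl2 in
theorem mainTheorem5 {k : Type*} [Field k] [CharZero k] (r : ℕ) (hr : 0 < r)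
    {N : Type*} [AddCommGroup N] [Module (R k) N] (π : RU k →ₐ[R k] Module.End (R k) N)
    (φ : LinearMap.BilinForm (R k) N) (hφ : IsInvariant π φ)
    (ι : P k r →ₗ[R k] N) (hι : Function.Injective ι)
    (hιU : ∀ (u : RU k) (x : P k r), ι (repP k r u x) = π u (ι x))
    (φp φm : LinearMap.BilinForm (FracR k) (ℕ →₀ FracR k))
    (hφp : IsShapovalov k r r φp) (hφm : IsShapovalov k (-r) 0 φm) :
    (∃! b : FracR k × FracR k, IsCombination (restrictForm φ ι) φp φm b.1 b.2) ∧
    ∀ bp bm : FracR k, IsCombination (restrictForm φ ι) φp φm bp bm →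
      (ord bp = ord bm ∧ ord bm < ord (bp + bm) →
        HasType (repP k r) r (formFiltration (B := P k r) (restrictForm φ ι))
          (ord bp + 1) (ord bp + 1) (ord bp + 1)) ∧
      (ord (bp + bm) = ord bp ∧ ord bp ≤ ord bm →
        HasType (repP k r) r (formFiltration (B := P k r) (restrictForm φ ι))
          (ord bp) (ord bp + 1) (ord bm + 2)) ∧
      (ord (bp + bm) = ord bm ∧ ord bm ≤ ord bp →
        HasType (repP k r) r (formFiltration (B := P k r) (restrictForm φ ι))
          (ord bm) (ord bp + 1) (ord bp + 2)) := by
  have hψ : IsInvariant (N := P k r) (repP k r) (restrictForm φ ι) := fun u a b => by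
    change φ (ι _) (ι _) = φ (ι _) (ι _)
    rw [hιU, hιU]
    exact hφ u (ι a) (ι b)
  refine ⟨existsUnique_isCombination hr hψ hφp hφm, fun bp bm hb => ⟨fun h => ?_, fun h => ?_,
    fun h => ?_⟩⟩
  · exact hasType_of_ord_lt hb hφp hφm h.1 h.2
  · have := hasType_of_ord_le hb hφp hφm (γ := ord bm + 2) h.1.le (by rw [h.1]; ac_rfl)
      (add_le_add h.2 le_rfl)
    rwa [h.1] at this
  · have := hasType_of_ord_le hb hφp hφm (γ := ord bp + 2) (h.1.trans_le h.2)
      (by rw [h.1]; ac_rfl) le_rfl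
    rwa [h.1] at this
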